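/- Let $\mathcal C$ be a finite set of $m\ge 1$ candidates and let $\mathbb N=\{1,2,3,\dots\}$ be the set of possible voters. An (approval) profile $A$ consists of a finite non-empty electorate $N_A\subset\mathbb N$ and a non-empty ballot $A_i\subseteq\mathcal C$ for each $i\in N_A$. Profiles $A,A'$ are disjoint if $N_A\cap N_{A'}=\emptyset$; then $A+A'$ is the profile with electorate $N_A\cup N_{A'}$ in which every voter keeps her ballot. For $j\ge 1$, $jA$ denotes a profile consisting of $j$ disjoint copies of $A$. A committee is a subset of $\mathcal C$. An ABC voting rule $f$ maps each profile $A$ and each $k\in\{0,\dots,m\}$ to a non-empty set $f(A,k)$ of committees of size $k$. The rule $f$ is - anonymous if $f(\pi(A),k)=f(A,k)$ for all $A$, $k$ and all bijections $\pi:\mathbb N\to\mathbb N$, where in $\pi(A)$ voter $\pi(i)$ reports $A_i$ for each $i\in N_A$; - neutral if $f(\tau(A),k)=\{\tau(W): W\in f(A,k)\}$ for all $A$, $k$ and all bijections $\tau:\mathcal C\to\mathcal C$, where in $\tau(A)$ voter $i$ reports $\tau(A_i)$ for each $i\in N_A$; - continuous if for all disjoint $A,A'$ and all $k$ with $|f(A,k)|=1$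 there is $j\ge 1$ with $f(jA+A',k)=f(A,k)$ for every choice of $jA$ disjoint from $A'$ (for anonymous rules this choice is irrelevant); - non-imposing if for every committee $W$ there is a profile $A$ with $f(A,|W|)=\{W\}$; - proper if it is anonymous, neutral, continuous and non-imposing. A generator function $g$ maps each profile $A$ and each committee $W\ne\mathcal C$ to a possibly empty set $g(A,W)\subseteq\mathcal C\setminus W$. It is consistent if, for all disjoint $A,A'$ and all committees $W\neq\mathcal C$, $g(A,W)\cap g(A',W)\ne\emptyset$ and $g(A+A',W)\ne\emptyset$ imply $g(A+A',W)=g(A,W)\cap g(A',W)$. It generates $f$ if for all $A$ and all $k\in\{1,\dots,m\}$, $g(A,W)\neq\emptyset$ for every $W\in f(A,k-1)$, and $f(A,k)=\{W\cup\{x\}: W\in f(A,k-1),\ x\in g(A,W)\}$. The rule $f$ is consistently committee monotone if it is generated by some consistent generator function. The rule $f$ is a step-dependent sequential scoring rule if there is a function $h:\{0,\dots,m\}\times\{1,\dots,m\}\times\{1,\dots,m\}\to\mathbb R$ such that for every $y\in\{1,\dots,m-1\}$ there are $x\in\{1,\dots,y\}$ and $z\in\{x,\dots,m-1-(y-x)\}$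 with $h(x,y,z)\ne h(x-1,y,z)$, and such that, with $s_h(A,W)=\sum_{i\in N_A}h(|A_i\cap W|,|W|,|A_i|)$ for non-empty committees $W$, one has $f(A,0)=\{\emptyset\}$ and, for all $A$ and all $k\in\{1,\dots,m\}$, $$f(A,k)=\{W\cup\{x\}: W\in f(A,k-1),\ x\in\mathcal C\setminus W,\ s_h(A,W\cup\{x\})\ge s_h(A,W\cup\{y\})\text{ for all }y\in\mathcal C\setminus W\}.$$ Theorem. An ABC voting rule is a step-dependent sequential scoring rule if and only if it is proper and consistently committee monotone. -/

import Mathlib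

/-! Approval-based committee (ABC) voting over a finite set `C` of candidates, with `ℕ+` as the
infinite set of all possible voters. Every `W : Finset C` is a committee; its size is `W.card`. -/

/-- An approval profile: a finite non-empty electorate whose members each report a non-empty set of
candidates. A ballot is never empty, so `ballot i = ∅` encodes exactly that voter `i` does not
belong to the electorate; thus two profiles are equal iff they have the same electorate and the
same ballots on it. -/
@[ext]
structure ApprovalProfile (C : Type*) where
  electorate : Finset ℕ+
  ballot : ℕ+ → Finset C
  mem_electorate_iff : ∀ i, i ∈ electorate ↔ (ballot i).Nonempty
  electorate_nonempty : electorate.Nonempty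

namespace ApprovalProfile

variable {C : Type*}

/-- Two profiles are disjoint if no voter reports a ballot in both. -/
def IsDisjoint (A A' : ApprovalProfile C) : Prop :=
  Disjoint A.electorate A'.electorate

/-- The profile `A + A'`, only used for disjoint `A`, `A'`: its electorate is the union of the two
electorates, and every voter keeps her ballot. -/
def add (A A' : ApprovalProfile C) : ApprovalProfile C where
  electorate := A.electorate ∪ A'.electorate
  ballot i := if i ∈ A.electorate then A.ballot i else A'.ballot i
  mem_electorate_iff i := by
    by_cases h : i ∈ A.electorate
    · simp [h, (A.mem_electorate_iff i).1 h]
    · simp [h, A'.mem_electorate_iff i]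
  electorate_nonempty := A.electorate_nonempty.mono Finset.subset_union_left

/-- The profile `π(A)`, in which voter `π i` reports the ballot of voter `i` in `A`. -/
def permuteVoters (π : Equiv.Perm ℕ+) (A : ApprovalProfile C) : ApprovalProfile C where
  electorate := A.electorate.map π.toEmbedding
  ballot i := A.ballot (π.symm i)
  mem_electorate_iff i := by
    rw [← A.mem_electorate_iff, Finset.mem_map_equiv]
  electorate_nonempty := A.electorate_nonempty.map

/-- The profile `τ(A)`, in which voter `i` reports the image under `τ` of her ballot in `A`. -/
def permuteCandidates (τ : Equiv.Perm C) (A : ApprovalProfile C) : ApprovalProfile C where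
  electorate := A.electorate
  ballot i := (A.ballot i).map τ.toEmbedding
  mem_electorate_iff i := by
    rw [Finset.map_nonempty, A.mem_electorate_iff]
  electorate_nonempty := A.electorate_nonempty

/-- `B` is a profile `jA`, i.e. it consists of `j` disjoint copies of `A`: its voters correspond
bijectively to the pairs (index of a copy, voter of `A`), with the same ballots. -/
def IsCopies (j : ℕ) (A B : ApprovalProfile C) : Prop :=
  ∃ e : Fin j × A.electorate ≃ B.electorate, ∀ p, B.ballot (e p) = A.ballot p.2

/-- The score `s_v(A, W) = ∑_{i ∈ N_A} v(A_i, W)`. -/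
noncomputable def score (v : Finset C → Finset C → ℝ) (A : ApprovalProfile C) (W : Finset C) : ℝ :=
  ∑ i ∈ A.electorate, v (A.ballot i) W

end ApprovalProfile

/-- An ABC voting rule assigns to every profile and every committee size `k ≤ |C|` a non-empty set
of committees of size `k`. (For `k > |C|` there is no such committee, so the value is forced to be
empty and carries no information.) -/
structure ABCVotingRule (C : Type*) [Fintype C] where
  winners : ApprovalProfile C → ℕ → Finset (Finset C)
  card_eq : ∀ A k, ∀ W ∈ winners A k, W.card = k
  nonempty : ∀ A k, k ≤ Fintype.card C → (winners A k).Nonempty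

/-- A generator function assigns to every profile `A` and every committee `W ≠ C` a possibly empty
subset of `C \ W`. (For `W = C` the value is forced to be empty and carries no information.) -/
structure GeneratorFunction (C : Type*) where
  extend : ApprovalProfile C → Finset C → Finset C
  notMem : ∀ A W, ∀ x ∈ extend A W, x ∉ W

/-- Consistency of a generator function. -/
def GeneratorFunction.IsConsistent {C : Type*} [Fintype C] [DecidableEq C]
    (g : GeneratorFunction C) : Prop :=
  ∀ A A' : ApprovalProfile C, A.IsDisjoint A' → ∀ W : Finset C, W ≠ Finset.univ →
    (g.extend A W ∩ g.extend A' W).Nonempty → (g.extend (A.add A') W).Nonempty →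
      g.extend (A.add A') W = g.extend A W ∩ g.extend A' W

namespace ABCVotingRule

variable {C : Type*} [Fintype C]

def IsAnonymous (f : ABCVotingRule C) : Prop :=
  ∀ (A : ApprovalProfile C) (k : ℕ), k ≤ Fintype.card C → ∀ π : Equiv.Perm ℕ+,
    f.winners A k = f.winners (A.permuteVoters π) k

def IsNeutral (f : ABCVotingRule C) : Prop :=
  ∀ (A : ApprovalProfile C) (k : ℕ), k ≤ Fintype.card C → ∀ τ : Equiv.Perm C,
    (f.winners (A.permuteCandidates τ) k : Set (Finset C)) =
      {V | ∃ W ∈ f.winners A k, V = W.map τ.toEmbedding}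

/-- Continuity. The profile `jA` may be any profile that consists of `j` disjoint copies of `A` and
is disjoint from `A'`; for anonymous rules the choice is irrelevant. -/
def IsContinuous (f : ABCVotingRule C) : Prop :=
  ∀ A A' : ApprovalProfile C, A.IsDisjoint A' → ∀ k : ℕ, k ≤ Fintype.card C →
    (f.winners A k).card = 1 →
      ∃ j : ℕ, 1 ≤ j ∧ ∀ B : ApprovalProfile C, A.IsCopies j B → B.IsDisjoint A' →
        f.winners (B.add A') k = f.winners A k

def IsNonImposing (f : ABCVotingRule C) : Prop :=
  ∀ W : Finset C, ∃ A : ApprovalProfile C, f.winners A W.card = {W}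

/-- A proper rule: anonymous, neutral, continuous, and non-imposing. -/
def IsProper (f : ABCVotingRule C) : Prop :=
  f.IsAnonymous ∧ f.IsNeutral ∧ f.IsContinuous ∧ f.IsNonImposing

/-- The generator function `g` generates the rule `f`. -/
def IsGeneratedBy [DecidableEq C] (f : ABCVotingRule C) (g : GeneratorFunction C) : Prop :=
  ∀ (A : ApprovalProfile C) (k : ℕ), k + 1 ≤ Fintype.card C →
    (∀ W ∈ f.winners A k, (g.extend A W).Nonempty) ∧
    (f.winners A (k + 1) : Set (Finset C)) =
      {V | ∃ W ∈ f.winners A k, ∃ x ∈ g.extend A W, V = insert x W}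

def IsConsistentlyCommitteeMonotone [DecidableEq C] (f : ABCVotingRule C) : Prop :=
  ∃ g : GeneratorFunction C, g.IsConsistent ∧ f.IsGeneratedBy g

/-- `f` is the sequential valuation rule of the valuation function `v`, where `v B W` is the number
of points that a voter with ballot `B` assigns to the committee `W`. -/
def IsSequentialValuationRuleOf [DecidableEq C] (f : ABCVotingRule C)
    (v : Finset C → Finset C → ℝ) : Prop :=
  ∀ A : ApprovalProfile C, f.winners A 0 = {∅} ∧
    ∀ k : ℕ, k + 1 ≤ Fintype.card C →
      (f.winners A (k + 1) : Set (Finset C)) =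
        {V | ∃ W ∈ f.winners A k, ∃ x, x ∉ W ∧
          (∀ y, y ∉ W → A.score v (insert x W) ≥ A.score v (insert y W)) ∧ V = insert x W}

end ABCVotingRule

/-- Step-dependent counting functions for `m` candidates. Only the values `h x y z` with
`0 ≤ x ≤ m`, `1 ≤ y ≤ m`, `1 ≤ z ≤ m` matter here and in the induced rule. The natural-number
subtractions are exact for `m ≥ 1`, since `1 ≤ x ≤ y ≤ m - 1`. -/
def IsStepDependentCountingFunction (m : ℕ) (h : ℕ → ℕ → ℕ → ℝ) : Prop :=
  ∀ y ∈ Finset.Icc 1 (m - 1), ∃ x ∈ Finset.Icc 1 y, ∃ z ∈ Finset.Icc x (m - 1 - (y - x)),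
    h x y z ≠ h (x - 1) y z

/-- A step-dependent sequential scoring rule is a sequential valuation rule whose valuation function
is `v(B, W) = h(|B ∩ W|, |W|, |B|)` for a step-dependent counting function `h`. -/
def ABCVotingRule.IsStepDependentSequentialScoringRule {C : Type*} [Fintype C] [DecidableEq C]
    (f : ABCVotingRule C) : Prop :=
  ∃ h : ℕ → ℕ → ℕ → ℝ, IsStepDependentCountingFunction (Fintype.card C) h ∧
    f.IsSequentialValuationRuleOf fun B W => h (B ∩ W).card W.card B.card

/-! From scoring rules to the axioms: scores are additive over disjoint profiles, so the maximizing
candidates form a consistent generator (`argmaxGenerator_isConsistent`), and enough copies of `A`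
preserve all its strict comparisons, which gives continuity. For non-imposition, the condition on
`h` yields, for any two extensions of a committee, a ballot that separates them. Score differences
are thus finitely many non-zero linear forms in the ballot multiplicities; a positive integer vector
off their kernels gives a profile without ties, and neutrality moves its winner to any committee.

From the axioms to a scoring rule: by anonymity only the vector of ballot multiplicities matters.
The rule determines the generator at `W` directly only where `W` is the sole winner of its size. To
get beyond this, take a vector `E` with full support that reaches `W` without ties and is symmetric
in the candidates outside `W`, so that all of them tie as extensions (`exists_base`). For every
integral vector `n`, large multiples of `E` turn `n` into a profile with sole winner `W`, by
continuity, and by consistency the extensions then no longer depend on the multiple. This defines a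
consistent choice `G` on the whole group of integral vectors that agrees with the generator wherever
`W` wins (`exists_isExtensionAt`).

A consistent choice on a group is governed by real functionals. For `x`, `y` outside `W`, the
vectors that favour `x` over `y`, up to vectors invariant under swapping the two, form a total
archimedean cone; Hölder's theorem turns it into an additive map to the reals (`exists_functional`).
After averaging over the permutations that stabilize `W` and fix `x` and `y`, its value on a ballot
that contains `x` but not `y` depends only on how many candidates the ballot has inside and outside
`W`. So `G` maximizes a weighted number of approvals (`exists_weight_mem_iff`). Neutrality makes the
weights depend on `W` only through its size, and their partial sums are the counting function. -/

/-! ### Profiles as vectors of ballot multiplicities. -/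

/-- The type of admissible ballots. -/
abbrev Ballot (C : Type*) := {B : Finset C // B.Nonempty}

/-- The action of candidate permutations on ballots. -/
def Ballot.perm {C : Type*} (τ : Equiv.Perm C) : Equiv.Perm (Ballot C) where
  toFun B := ⟨B.1.map τ.toEmbedding, B.2.map⟩
  invFun B := ⟨B.1.map τ.symm.toEmbedding, B.2.map⟩
  left_inv B := by ext; simp
  right_inv B := by ext; simp

@[simp]
theorem Ballot.perm_coe {C : Type*} (τ : Equiv.Perm C) (B : Ballot C) :
    (Ballot.perm τ B).1 = B.1.map τ.toEmbedding := rfl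

@[simp]
theorem Ballot.perm_symm_coe {C : Type*} (τ : Equiv.Perm C) (B : Ballot C) :
    ((Ballot.perm τ).symm B).1 = B.1.map τ.symm.toEmbedding := rfl

namespace ApprovalProfile

variable {C : Type*}

/-- Every finite non-empty family of ballots is cast by an electorate that avoids a given finite set
of voters. -/
theorem exists_of_family {T : Type*} [Fintype T] [Nonempty T] (b : T → Ballot C)
    (S : Finset ℕ+) :
    ∃ A : ApprovalProfile C, Disjoint A.electorate S ∧
      ∃ e : T ≃ A.electorate, ∀ t, A.ballot (e t) = b t := by
  classical
  have hinf : Infinite {i : ℕ+ // i ∉ S} :=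
    (Set.infinite_coe_iff (s := {i : ℕ+ | i ∉ S})).2 S.finite_toSet.infinite_compl
  let emb : T ↪ ℕ+ := ((Fintype.equivFin T).toEmbedding.trans
    (Fin.valEmbedding.trans (Infinite.natEmbedding {i : ℕ+ // i ∉ S}))).trans
    (Function.Embedding.subtype _)
  have hemb : ∀ t, emb t ∉ S := fun t => by
    exact (Infinite.natEmbedding {i : ℕ+ // i ∉ S} (Fintype.equivFin T t)).2
  have hch : ∀ t (h : ∃ t', emb t' = emb t), h.choose = t := fun t h =>
    emb.injective h.choose_spec
  refine ⟨⟨Finset.univ.map emb, fun i => if h : ∃ t, emb t = i then b h.choose else ∅, ?_, ?_⟩,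
    ?_, ?_⟩
  · intro i
    by_cases h : ∃ t, emb t = i
    · simp only [h, dite_true, Finset.mem_map, Finset.mem_univ, true_and, true_iff]
      exact (b h.choose).2
    · simp only [h, dite_false, Finset.mem_map, Finset.mem_univ, true_and, Finset.not_nonempty_empty]
  · exact Finset.univ_nonempty.map
  · rw [Finset.disjoint_left]
    intro i hi
    obtain ⟨t, -, rfl⟩ := Finset.mem_map.1 hi
    exact hemb t
  · refine ⟨Equiv.ofBijective (fun t => ⟨emb t, by simp⟩) ⟨?_, ?_⟩, ?_⟩
    · intro s t h
      exact emb.injective (Subtype.mk.inj h)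
    · rintro ⟨i, hi⟩
      obtain ⟨t, -, rfl⟩ := Finset.mem_map.1 hi
      exact ⟨t, rfl⟩
    · intro t
      have h : ∃ t', emb t' = emb t := ⟨t, rfl⟩
      exact (dif_pos h).trans (congrArg (fun t => (b t).1) (hch t h))

theorem exists_isCopies (A : ApprovalProfile C) {j : ℕ} (hj : 1 ≤ j) (S : Finset ℕ+) :
    ∃ B : ApprovalProfile C, A.IsCopies j B ∧ Disjoint B.electorate S := by
  have : Nonempty (Fin j) := ⟨⟨0, hj⟩⟩
  have : Nonempty A.electorate := A.electorate_nonempty.to_subtype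
  obtain ⟨B, hB, e, he⟩ := exists_of_family
    (fun p : Fin j × A.electorate => (⟨A.ballot p.2, (A.mem_electorate_iff _).1 p.2.2⟩ : Ballot C)) S
  exact ⟨B, ⟨e, he⟩, hB⟩

variable [DecidableEq C]

/-- The number of voters who cast a given ballot. -/
def count (A : ApprovalProfile C) (B : Ballot C) : ℤ :=
  (A.electorate.filter fun i => A.ballot i = B.1).card

theorem count_nonneg (A : ApprovalProfile C) : 0 ≤ A.count := fun B => by
  simp [count]

theorem count_eq_card (A : ApprovalProfile C) (B : Ballot C) :
    A.count B = Fintype.card {i : A.electorate // A.ballot i = B.1} := by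
  rw [count, Fintype.card_subtype, Finset.univ_eq_attach,
    ← Finset.card_map (Function.Embedding.subtype _)]
  congr 2
  ext i
  simp [and_comm]

theorem count_eq_card_of_equiv {T : Type*} [Fintype T] (A : ApprovalProfile C)
    (e : T ≃ A.electorate) (B : Ballot C) :
    A.count B = Fintype.card {t : T // A.ballot (e t) = B.1} := by
  rw [count_eq_card, Nat.cast_inj]
  exact Fintype.card_congr (e.subtypeEquiv fun t => Iff.rfl).symm

theorem count_pos_iff (A : ApprovalProfile C) (B : Ballot C) :
    0 < A.count B ↔ ∃ i, A.ballot i = B.1 := by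
  rw [count, Nat.cast_pos, Finset.card_pos]
  constructor
  · rintro ⟨i, hi⟩
    exact ⟨i, (Finset.mem_filter.1 hi).2⟩
  · rintro ⟨i, hi⟩
    exact ⟨i, Finset.mem_filter.2 ⟨(A.mem_electorate_iff i).2 (hi ▸ B.2), hi⟩⟩

theorem count_ne_zero (A : ApprovalProfile C) : A.count ≠ 0 := by
  intro h
  obtain ⟨i, hi⟩ := A.electorate_nonempty
  have := (A.count_pos_iff ⟨A.ballot i, (A.mem_electorate_iff i).1 hi⟩).2 ⟨i, rfl⟩
  simp [h] at this

theorem exists_count_eq [Fintype C] {n : Ballot C → ℤ} (h0 : 0 ≤ n) (hn : n ≠ 0) (S : Finset ℕ+) :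
    ∃ A : ApprovalProfile C, A.count = n ∧ Disjoint A.electorate S := by
  lift n to Ballot C → ℕ using h0
  have : Nonempty (Σ B, Fin (n B)) := by
    obtain ⟨B, hB⟩ := Function.ne_iff.1 hn
    refine ⟨⟨B, ⟨0, Nat.pos_of_ne_zero fun h => hB ?_⟩⟩⟩
    simp [h]
  obtain ⟨A, hA, e, he⟩ := exists_of_family (fun t : Σ B, Fin (n B) => t.1) S
  refine ⟨A, funext fun B => ?_, hA⟩
  rw [count_eq_card_of_equiv A e]
  simp only [he, Subtype.val_inj]
  rw [Fintype.card_congr (Equiv.sigmaSubtype B), Fintype.card_fin]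

/-- This is what makes anonymous rules functions of `count`: for each ballot the two sets of voters
casting it are equinumerous, the resulting bijections glue to one between the electorates, and it
extends to all of `ℕ+` because electorates are finite. -/
theorem exists_permuteVoters_eq [Fintype C] {A A' : ApprovalProfile C} (h : A.count = A'.count) :
    ∃ π : Equiv.Perm ℕ+, A.permuteVoters π = A' := by
  have hfib : ∀ B : Ballot C, Nonempty ({i : A.electorate // (⟨A.ballot i, (A.mem_electorate_iff i).1 i.2⟩ : Ballot C) = B} ≃
      {i : A'.electorate // (⟨A'.ballot i, (A'.mem_electorate_iff i).1 i.2⟩ : Ballot C) = B}) := by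
    intro B
    have := congrFun h B
    rw [count_eq_card, count_eq_card, Nat.cast_inj] at this
    simp only [Subtype.ext_iff]
    exact ⟨Fintype.equivOfCardEq this⟩
  let F := fun B => (hfib B).some
  let e := Equiv.ofFiberEquiv F
  have he : ∀ i, A'.ballot (e i) = A.ballot i := fun i =>
    congrArg Subtype.val (Equiv.ofFiberEquiv_map F i)
  obtain ⟨π, hπ⟩ := Equiv.Perm.exists_extending_pair (fun i : A.electorate => (i : ℕ+))
    (fun i => (e i : ℕ+)) Subtype.val_injective (Subtype.val_injective.comp e.injective)
  have hel : (A.permuteVoters π).electorate = A'.electorate := by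
    ext i
    simp only [permuteVoters, Finset.mem_map_equiv]
    constructor
    · intro hi
      have := hπ ⟨_, hi⟩
      simp only [Equiv.apply_symm_apply] at this
      rw [this]
      exact (e _).2
    · intro hi
      have := hπ (e.symm ⟨i, hi⟩)
      simp only [Equiv.apply_symm_apply] at this
      rw [← this, Equiv.symm_apply_apply]
      exact (e.symm _).2
  refine ⟨π, ApprovalProfile.ext hel (funext fun i => ?_)⟩
  by_cases hi : i ∈ A'.electorate
  · have h1 := hπ (e.symm ⟨i, hi⟩)
    have h2 := he (e.symm ⟨i, hi⟩)
    simp only [Equiv.apply_symm_apply] at h1 h2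
    rw [h2]
    change A.ballot (π.symm i) = _
    congr 1
    rw [Equiv.symm_apply_eq, h1]
  · have h1 := hi
    rw [← hel, mem_electorate_iff, Finset.not_nonempty_iff_eq_empty] at hi
    rw [mem_electorate_iff, Finset.not_nonempty_iff_eq_empty] at h1
    rw [hi, h1]

theorem count_add {A A' : ApprovalProfile C} (h : A.IsDisjoint A') :
    (A.add A').count = A.count + A'.count := by
  funext B
  simp only [count, Pi.add_apply]
  rw [← Nat.cast_add, Nat.cast_inj, ← Finset.card_union_of_disjoint]
  · congr 1
    ext i
    rw [Finset.mem_union, Finset.mem_filter, Finset.mem_filter, Finset.mem_filter]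
    simp only [add, Finset.mem_union]
    by_cases hi : i ∈ A.electorate
    · simp [hi, Finset.disjoint_left.1 h hi]
    · simp [hi]
  · exact Finset.disjoint_filter_filter h

theorem count_of_isCopies {A B : ApprovalProfile C} {j : ℕ} (h : A.IsCopies j B) :
    B.count = j • A.count := by
  obtain ⟨e, he⟩ := h
  funext D
  rw [count_eq_card_of_equiv B e, Pi.smul_apply, count_eq_card, nsmul_eq_mul, ← Nat.cast_mul]
  simp only [he]
  congr 1
  have e' : {t : Fin j × A.electorate // A.ballot t.2 = D.1} ≃
      Fin j × {i : A.electorate // A.ballot i = D.1} :=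
    ⟨fun t => (t.1.1, ⟨t.1.2, t.2⟩), fun t => ⟨(t.1, t.2.1), t.2.2⟩, fun _ => rfl, fun _ => rfl⟩
  rw [Fintype.card_congr e', Fintype.card_prod, Fintype.card_fin]

theorem count_permuteCandidates (A : ApprovalProfile C) (τ : Equiv.Perm C) :
    (A.permuteCandidates τ).count = A.count ∘ (Ballot.perm τ).symm := by
  funext B
  simp only [count, permuteCandidates, Function.comp, Ballot.perm_symm_coe]
  congr 2
  refine Finset.filter_congr fun i _ => ?_
  rw [← Finset.map_inj (f := τ.toEmbedding) (s₂ := Finset.map _ _)]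
  simp [Finset.map_map]

theorem score_eq_sum [Fintype C] (v : Finset C → Finset C → ℝ) (A : ApprovalProfile C)
    (W : Finset C) : A.score v W = ∑ B : Ballot C, A.count B * v B.1 W := by
  rw [score, ← Finset.sum_attach]
  rw [← Finset.sum_fiberwise (s := A.electorate.attach)
    (g := fun i => (⟨A.ballot i, (A.mem_electorate_iff i).1 i.2⟩ : Ballot C))]
  refine Finset.sum_congr rfl fun B _ => ?_
  rw [Finset.sum_congr rfl (g := fun _ => v B.1 W)]
  · rw [Finset.sum_const, nsmul_eq_mul]
    congr 1
    rw [count_eq_card, Fintype.card_subtype, Int.cast_natCast, Finset.univ_eq_attach]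
    simp only [Subtype.ext_iff]
  · intro i hi
    rw [← (Finset.mem_filter.1 hi).2]

end ApprovalProfile

/-! ### Hölder's theorem for total archimedean cones. -/

/-- Hölder's theorem for a total cone of an abelian group: if the cone is archimedean, it is the
preimage of the non-negative reals under a real-valued additive map. -/
theorem AddSubmonoid.exists_addMonoidHom_real_of_archimedean {Γ : Type*} [AddCommGroup Γ]
    (M : AddSubmonoid Γ) (htot : ∀ a, a ∈ M ∨ -a ∈ M)
    (harch : ∀ a b, b ∈ M → -b ∉ M → ∃ j : ℕ, j • b - a ∈ M) :
    ∃ φ : Γ →+ ℝ, ∀ a, a ∈ M ↔ 0 ≤ φ a := by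
  classical
  -- Dividing by the units of the cone makes it pointed, so the quotient is a linearly ordered
  -- archimedean group and embeds into the reals.
  let K : AddSubgroup Γ :=
    { carrier := {a | a ∈ M ∧ -a ∈ M}
      add_mem' := fun ha hb => ⟨M.add_mem ha.1 hb.1, by
        rw [neg_add]; exact M.add_mem ha.2 hb.2⟩
      zero_mem' := ⟨M.zero_mem, by rw [neg_zero]; exact M.zero_mem⟩
      neg_mem' := fun ha => ⟨ha.2, by rw [neg_neg]; exact ha.1⟩ }
  let q : Γ →+ Γ ⧸ K := QuotientAddGroup.mk' K
  have hq : ∀ a, q a ∈ M.map q ↔ a ∈ M := by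
    intro a
    refine ⟨?_, fun h => ⟨a, h, rfl⟩⟩
    rintro ⟨b, hb, hab⟩
    have h : -b + a ∈ K := QuotientAddGroup.eq.1 hab
    have := M.add_mem hb h.1
    rwa [add_neg_cancel_left] at this
  have hsurj : Function.Surjective q := QuotientAddGroup.mk'_surjective K
  let P : AddGroupCone (Γ ⧸ K) :=
    { M.map q with
      eq_zero_of_mem_of_neg_mem' := by
        intro a h1 h2
        obtain ⟨a, rfl⟩ := hsurj a
        exact (QuotientAddGroup.eq_zero_iff a).2 ⟨(hq a).1 h1, (hq (-a)).1 (by rwa [map_neg])⟩ }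
  have hP : ∀ a, q a ∈ P ↔ a ∈ M := hq
  have : HasMemOrNegMem P := ⟨fun a => by
    obtain ⟨a, rfl⟩ := hsurj a
    rw [← map_neg, hP, hP]
    exact htot a⟩
  let _ : LinearOrder (Γ ⧸ K) := LinearOrder.mkOfAddGroupCone P
  have : IsOrderedAddMonoid (Γ ⧸ K) := IsOrderedAddMonoid.mkOfCone P
  have hle : ∀ a b : Γ, q a ≤ q b ↔ b - a ∈ M := fun a b => by
    rw [← hP, map_sub]; rfl
  have : Archimedean (Γ ⧸ K) := ⟨fun a b hb => by
    obtain ⟨a, rfl⟩ := hsurj a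
    obtain ⟨b, rfl⟩ := hsurj b
    rw [← map_zero q, lt_iff_le_not_ge, hle, hle, sub_zero, zero_sub] at hb
    obtain ⟨j, hj⟩ := harch a b hb.1 hb.2
    exact ⟨j, by rwa [← map_nsmul, hle]⟩⟩
  obtain ⟨ψ, hψ⟩ := Archimedean.exists_orderAddMonoidHom_real_injective (Γ ⧸ K)
  have hmono : StrictMono ψ := (OrderHomClass.mono ψ).strictMono_of_injective hψ
  refine ⟨(ψ : Γ ⧸ K →+ ℝ).comp q, fun a => ?_⟩
  rw [AddMonoidHom.comp_apply, ← hP]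
  have : q a ∈ P ↔ q 0 ≤ q a := by rw [hle, sub_zero, hP]
  rw [this, map_zero, ← hmono.le_iff_le, map_zero]
  rfl

/-! ### Consistent choices on integral vectors and the functionals that compare two candidates. -/

/-- The action of candidate permutations on vectors of ballot multiplicities. -/
def permVec {C : Type*} (τ : Equiv.Perm C) : (Ballot C → ℤ) →+ (Ballot C → ℤ) where
  toFun n := n ∘ (Ballot.perm τ).symm
  map_zero' := rfl
  map_add' _ _ := rfl

theorem permVec_apply {C : Type*} (τ : Equiv.Perm C) (n : Ballot C → ℤ) (B : Ballot C) :
    permVec τ n B = n ((Ballot.perm τ).symm B) := rfl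

theorem permVec_permVec {C : Type*} (τ σ : Equiv.Perm C) (n : Ballot C → ℤ) :
    permVec τ (permVec σ n) = permVec (τ * σ) n := by
  funext B
  simp only [permVec_apply]
  congr 1
  ext1
  simp only [Ballot.perm_symm_coe, Finset.map_map]
  rfl

theorem permVec_swap_swap {C : Type*} [DecidableEq C] (x y : C) (n : Ballot C → ℤ) :
    permVec (Equiv.swap x y) (permVec (Equiv.swap x y) n) = n := by
  rw [permVec_permVec, Equiv.swap_mul_self]
  funext B
  rw [permVec_apply]
  congr 1
  ext1
  exact Finset.map_refl

theorem Finset.map_swap_eq_self {C : Type*} [DecidableEq C] {W : Finset C} {x y : C} (hx : x ∉ W) (hy : y ∉ W) :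
    W.map (Equiv.swap x y).toEmbedding = W := by
  have : ∀ w ∈ W, Equiv.swap x y w = w := fun w hw =>
    Equiv.swap_apply_of_ne_of_ne (fun e => hx (e ▸ hw)) (fun e => hy (e ▸ hw))
  refine Finset.eq_of_subset_of_card_le (fun w hw => ?_) (Finset.card_map _).ge
  obtain ⟨v, hv, rfl⟩ := Finset.mem_map.1 hw
  rw [Equiv.coe_toEmbedding, this v hv]
  exact hv

/-- A choice of candidates outside `W` for each vector of ballot multiplicities that is consistent,
neutral with respect to the stabilizer of `W`, continuous, and somewhere single-valued. -/
structure IsConsistentChoice {C : Type*} [Fintype C] [DecidableEq C] (W : Finset C)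
    (G : (Ballot C → ℤ) → Finset C) : Prop where
  nonempty : ∀ n, (G n).Nonempty
  notMem : ∀ n, ∀ x ∈ G n, x ∉ W
  add_eq : ∀ n n', (G n ∩ G n').Nonempty → G (n + n') = G n ∩ G n'
  zero : ∀ x, x ∉ W → x ∈ G 0
  perm : ∀ τ : Equiv.Perm C, W.map τ.toEmbedding = W → ∀ n,
    G (permVec τ n) = (G n).map τ.toEmbedding
  continuous : ∀ n x, G n = {x} → ∀ n', ∃ j : ℕ, 1 ≤ j ∧ G (j • n + n') = {x}
  exists_singleton : ∃ n x, G n = {x}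

namespace IsConsistentChoice

variable {C : Type*} [Fintype C] [DecidableEq C] {W : Finset C} {G : (Ballot C → ℤ) → Finset C}

theorem mem_add (h : IsConsistentChoice W G) {n n' : Ballot C → ℤ} {x : C} (hx : x ∈ G n)
    (hx' : x ∈ G n') : x ∈ G (n + n') := by
  rw [h.add_eq n n' ⟨x, Finset.mem_inter.2 ⟨hx, hx'⟩⟩]
  exact Finset.mem_inter.2 ⟨hx, hx'⟩

theorem mem_and_mem_of_mem_add (h : IsConsistentChoice W G) {n n' : Ballot C → ℤ} {x y : C}
    (hx : x ∈ G n) (hx' : x ∈ G n') (hy : y ∈ G (n + n')) : y ∈ G n ∧ y ∈ G n' := by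
  rwa [h.add_eq n n' ⟨x, Finset.mem_inter.2 ⟨hx, hx'⟩⟩, Finset.mem_inter] at hy

theorem mem_nsmul (h : IsConsistentChoice W G) {n : Ballot C → ℤ} {x : C} (hx : x ∈ G n) (j : ℕ) :
    x ∈ G (j • n) := by
  induction j with
  | zero => rw [zero_nsmul]; exact h.zero x (h.notMem n x hx)
  | succ j ih => rw [succ_nsmul]; exact h.mem_add ih hx

theorem mem_sum (h : IsConsistentChoice W G) {ι : Type*} (s : Finset ι) (n : ι → Ballot C → ℤ)
    {x : C} (hxW : x ∉ W) (hx : ∀ i ∈ s, x ∈ G (n i)) : x ∈ G (∑ i ∈ s, n i) := by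
  classical
  induction s using Finset.induction_on with
  | empty => exact h.zero x hxW
  | insert i s hi ih =>
    rw [Finset.sum_insert hi]
    exact h.mem_add (hx i (Finset.mem_insert_self i s))
      (ih fun j hj => hx j (Finset.mem_insert_of_mem hj))

theorem mem_of_mem_sum (h : IsConsistentChoice W G) {ι : Type*} (s : Finset ι)
    (n : ι → Ballot C → ℤ) {x y : C} (hxW : x ∉ W) (hx : ∀ i ∈ s, x ∈ G (n i))
    (hy : y ∈ G (∑ i ∈ s, n i)) : ∀ i ∈ s, y ∈ G (n i) := by
  classical
  intro i hi
  rw [← Finset.add_sum_erase s n hi] at hy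
  exact (h.mem_and_mem_of_mem_add (hx i hi)
    (h.mem_sum _ n hxW fun j hj => hx j (Finset.mem_of_mem_erase hj)) hy).1

theorem mem_permVec (h : IsConsistentChoice W G) {τ : Equiv.Perm C}
    (hτ : W.map τ.toEmbedding = W) {n : Ballot C → ℤ} {x : C} :
    τ x ∈ G (permVec τ n) ↔ x ∈ G n := by
  rw [h.perm τ hτ]
  exact Finset.mem_map' _

/-- There is a vector for which only `z` is chosen and that does not distinguish the other candidates
outside `W`. -/
theorem exists_invariant_singleton (h : IsConsistentChoice W G) {z : C} (hz : z ∉ W) :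
    ∃ p, G p = {z} ∧ ∀ u v, u ∉ W → v ∉ W → u ≠ z → v ≠ z → permVec (Equiv.swap u v) p = p := by
  classical
  obtain ⟨n, x, hn⟩ := h.exists_singleton
  have hx : x ∉ W := h.notMem n x (by simp [hn])
  -- The vector is symmetrized over the stabilizer of `W` and `z`; every summand chooses `z` alone,
  -- hence so does the sum.
  let H : Finset (Equiv.Perm C) := Finset.univ.filter fun τ => W.map τ.toEmbedding = W ∧ τ z = z
  have hn' : G (permVec (Equiv.swap x z) n) = {z} := by
    rw [h.perm _ (Finset.map_swap_eq_self hx hz), hn]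
    simp
  set n' := permVec (Equiv.swap x z) n
  have hτ : ∀ τ ∈ H, G (permVec τ n') = {z} := fun τ hτ => by
    obtain ⟨-, h1, h2⟩ := Finset.mem_filter.1 hτ
    rw [h.perm τ h1, hn']
    simp [h2]
  have h1 : (1 : Equiv.Perm C) ∈ H := by
    simp only [H, Finset.mem_filter, Finset.mem_univ, true_and, Equiv.Perm.one_apply, and_true]
    exact Finset.map_refl
  refine ⟨∑ τ ∈ H, permVec τ n', ?_, ?_⟩
  · have hmem : ∀ τ ∈ H, z ∈ G (permVec τ n') := fun τ h => by simp [hτ τ h]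
    refine Finset.eq_singleton_iff_unique_mem.2 ⟨h.mem_sum H _ hz hmem, fun y hy => ?_⟩
    have := h.mem_of_mem_sum H _ hz hmem hy 1 h1
    rw [hτ 1 h1] at this
    exact Finset.mem_singleton.1 this
  · intro u v hu hv huz hvz
    rw [map_sum]
    simp only [permVec_permVec]
    have hW := Finset.map_swap_eq_self hu hv
    have hsz : Equiv.swap u v z = z := Equiv.swap_apply_of_ne_of_ne huz.symm hvz.symm
    have key : ∀ τ ∈ H, Equiv.swap u v * τ ∈ H := fun τ hτ => by
      obtain ⟨-, h1, h2⟩ := Finset.mem_filter.1 hτ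
      refine Finset.mem_filter.2 ⟨Finset.mem_univ _, ?_, by rw [Equiv.Perm.mul_apply, h2, hsz]⟩
      have : W.map (Equiv.swap u v * τ).toEmbedding =
          (W.map τ.toEmbedding).map (Equiv.swap u v).toEmbedding := by
        rw [Finset.map_map]; rfl
      rw [this, h1, hW]
    refine Finset.sum_nbij' (fun τ => Equiv.swap u v * τ) (fun τ => Equiv.swap u v * τ) key key
      ?_ ?_ ?_
    · intro τ _
      rw [← mul_assoc, Equiv.swap_mul_self, one_mul]
    · intro τ _
      rw [← mul_assoc, Equiv.swap_mul_self, one_mul]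
    · intro τ _
      rfl

/-- Since `p + -p = 0` ties everybody, `z` cannot be chosen at `-p` as well as at `p`. Some other
candidate is chosen at `-p`, and the symmetry of `p` carries it to `x`. -/
theorem mem_neg_of_invariant (h : IsConsistentChoice W G) {x z : C} (hx : x ∉ W)
    (hxz : x ≠ z) {p : Ballot C → ℤ} (hp : G p = {z})
    (hinv : ∀ u v, u ∉ W → v ∉ W → u ≠ z → v ≠ z → permVec (Equiv.swap u v) p = p) :
    x ∈ G (-p) ∧ z ∉ G (-p) := by
  have hz : z ∉ G (-p) := fun hz => by
    have := (h.mem_and_mem_of_mem_add (n := p) (by simp [hp]) hz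
      (by rw [add_neg_cancel]; exact h.zero x hx)).1
    rw [hp, Finset.mem_singleton] at this
    exact hxz this
  refine ⟨?_, hz⟩
  obtain ⟨y, hy⟩ := h.nonempty (-p)
  have hyW := h.notMem _ _ hy
  have hyz : y ≠ z := fun e => hz (e ▸ hy)
  rw [← h.mem_permVec (Finset.map_swap_eq_self hyW hx), map_neg, hinv y x hyW hx hyz hxz] at hy
  simpa using hy

/-- There is a vector for which exactly `x` and `y` are chosen, and which enforces this choice when
added sufficiently often. -/
theorem exists_pair (h : IsConsistentChoice W G) {x y : C} (hx : x ∉ W) (hy : y ∉ W) :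
    ∃ n₀, G n₀ = {x, y} ∧ permVec (Equiv.swap x y) n₀ = n₀ ∧
      ∀ n, ∃ j : ℕ, G (n + j • n₀) ⊆ {x, y} := by
  classical
  have hex : ∀ z, ∃ p, z ∉ W → (G p = {z} ∧
      ∀ u v, u ∉ W → v ∉ W → u ≠ z → v ≠ z → permVec (Equiv.swap u v) p = p) := fun z => by
    by_cases hz : z ∈ W
    · exact ⟨0, fun h => absurd hz h⟩
    · obtain ⟨p, hp⟩ := h.exists_invariant_singleton hz
      exact ⟨p, fun _ => hp⟩
  choose p hp using hex
  let Z : Finset C := Wᶜ \ {x, y}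
  have hZ : ∀ z ∈ Z, z ∉ W ∧ x ≠ z ∧ y ≠ z := fun z hz => by
    simp only [Z, Finset.mem_sdiff, Finset.mem_compl, Finset.mem_insert, Finset.mem_singleton] at hz
    tauto
  have hxm : ∀ z ∈ Z, x ∈ G (-p z) := fun z hz =>
    (h.mem_neg_of_invariant hx (hZ z hz).2.1 (hp z (hZ z hz).1).1 (hp z (hZ z hz).1).2).1
  have hym : ∀ z ∈ Z, y ∈ G (-p z) := fun z hz =>
    (h.mem_neg_of_invariant hy (hZ z hz).2.2 (hp z (hZ z hz).1).1 (hp z (hZ z hz).1).2).1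
  have hzm : ∀ z ∈ Z, z ∉ G (-p z) := fun z hz =>
    (h.mem_neg_of_invariant hy (hZ z hz).2.2 (hp z (hZ z hz).1).1 (hp z (hZ z hz).1).2).2
  -- Each `-p z` excludes exactly `z`, so the sum leaves only `x` and `y`.
  refine ⟨∑ z ∈ Z, -p z, ?_, ?_, ?_⟩
  · ext z
    rw [Finset.mem_insert, Finset.mem_singleton]
    constructor
    · intro hz
      by_contra hne
      have hzZ : z ∈ Z := by
        simp only [Z, Finset.mem_sdiff, Finset.mem_compl, Finset.mem_insert, Finset.mem_singleton]
        exact ⟨h.notMem _ _ hz, hne⟩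
      exact hzm z hzZ (h.mem_of_mem_sum Z _ hx hxm hz z hzZ)
    · rintro (rfl | rfl)
      · exact h.mem_sum Z _ hx hxm
      · exact h.mem_sum Z _ hy hym
  · rw [map_sum]
    refine Finset.sum_congr rfl fun z hz => ?_
    rw [map_neg, (hp z (hZ z hz).1).2 x y hx hy (hZ z hz).2.1 (hZ z hz).2.2]
  · intro n
    -- By continuity `l z • p z - n` chooses only `z`. If `z` were chosen at `n + j • n₀` with `j ≥
    -- l z`, it would be the sole choice at the sum of the two vectors; but this sum is a
    -- non-negative combination of the vectors `-p`, at which `x` is chosen.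
    have hl : ∀ z, ∃ l : ℕ, z ∈ Z → G (l • p z + -n) = {z} := fun z => by
      by_cases hz : z ∈ Z
      · obtain ⟨l, -, hl⟩ := h.continuous _ z (hp z (hZ z hz).1).1 (-n)
        exact ⟨l, fun _ => hl⟩
      · exact ⟨0, fun h => absurd h hz⟩
    choose l hl using hl
    refine ⟨Z.sup l, fun z hz => ?_⟩
    by_contra hne
    have hzZ : z ∈ Z := by
      simp only [Z, Finset.mem_sdiff, Finset.mem_compl]
      exact ⟨h.notMem _ _ hz, hne⟩
    obtain ⟨i, hi⟩ := Nat.exists_eq_add_of_le (Finset.le_sup (f := l) hzZ)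
    have hxe : x ∈ G ((l z • p z + -n) + (n + Z.sup l • ∑ z ∈ Z, -p z)) := by
      have : (l z • p z + -n) + (n + Z.sup l • ∑ z ∈ Z, -p z) =
          i • (-p z) + Z.sup l • ∑ z ∈ Z.erase z, -p z := by
        rw [← Finset.add_sum_erase Z _ hzZ, smul_add, hi, add_smul (l z) i (-p z)]
        simp only [smul_neg]
        abel
      rw [this]
      exact h.mem_add (h.mem_nsmul (hxm z hzZ) _) (h.mem_nsmul
        (h.mem_sum _ _ hx fun z hz => hxm z (Finset.mem_of_mem_erase hz)) _)
    have := (h.mem_and_mem_of_mem_add (by rw [hl z hzZ]; simp) hz hxe).1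
    rw [hl z hzZ, Finset.mem_singleton] at this
    exact (hZ z hzZ).2.1 this

/-- A real-valued functional that compares the candidates `x` and `y`. -/
theorem exists_functional (h : IsConsistentChoice W G) {x y : C} (hx : x ∉ W) (hy : y ∉ W)
    (hxy : x ≠ y) :
    ∃ φ : (Ballot C → ℤ) →+ ℝ, (∀ n, x ∈ G n → 0 ≤ φ n) ∧ (∀ n, x ∈ G n → y ∉ G n → 0 < φ n) ∧
      ∀ n, φ (permVec (Equiv.swap x y) n) = -φ n := by
  obtain ⟨n₀, hn₀, hσ₀, hpair⟩ := h.exists_pair hx hy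
  have hW := Finset.map_swap_eq_self hx hy
  set σ := permVec (Equiv.swap x y)
  have hσσ : ∀ n, σ (σ n) = n := permVec_swap_swap x y
  have hσx : ∀ n, x ∈ G (σ n) ↔ y ∈ G n := fun n => by
    have := h.mem_permVec hW (n := n) (x := y)
    rwa [Equiv.swap_apply_right] at this
  have hσy : ∀ n, y ∈ G (σ n) ↔ x ∈ G n := fun n => by
    have := h.mem_permVec hW (n := n) (x := x)
    rwa [Equiv.swap_apply_left] at this
  -- Only the antisymmetric part `n - σ n` matters for membership: adding a swap-invariant vector
  -- must not affect the comparison of `x` and `y`.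
  let M : AddSubmonoid (Ballot C → ℤ) :=
    { carrier := {n | ∃ n', n' - σ n' = n - σ n ∧ x ∈ G n'}
      zero_mem' := ⟨0, rfl, h.zero x hx⟩
      add_mem' := by
        rintro a b ⟨a', ha, hxa⟩ ⟨b', hb, hxb⟩
        refine ⟨a' + b', ?_, h.mem_add hxa hxb⟩
        rw [map_add, map_add, add_sub_add_comm, ha, hb, add_sub_add_comm] }
  have hM : ∀ n, n ∈ M ↔ ∃ n', n' - σ n' = n - σ n ∧ x ∈ G n' := fun n => Iff.rfl
  obtain ⟨φ, hφ⟩ := M.exists_addMonoidHom_real_of_archimedean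
    (by
      intro n
      -- Totality: adding multiples of `n₀` keeps the antisymmetric part and leaves only `x` or `y`
      -- to be chosen; if it is `y`, the swap gives a witness for `-n`.
      obtain ⟨j, hj⟩ := hpair n
      obtain ⟨z, hz⟩ := h.nonempty (n + j • n₀)
      have := hj hz
      rw [Finset.mem_insert, Finset.mem_singleton] at this
      rcases this with rfl | rfl
      · refine Or.inl ⟨_, ?_, hz⟩
        rw [map_add, map_nsmul, hσ₀, add_sub_add_right_eq_sub]
      · refine Or.inr ⟨_, ?_, (hσx _).2 hz⟩
        rw [hσσ, map_add, map_nsmul, hσ₀, add_sub_add_right_eq_sub, map_neg]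
        abel)
    (by
      rintro a b ⟨n, hn, hxn⟩ hb
      -- Archimedean property: strict positivity of `b` excludes `y` at its witness `n`, so `n + n₀`
      -- chooses `x` alone and, by continuity, its multiples outweigh `-a`.
      have hyn : y ∉ G n := fun hyn => hb ⟨σ n, by
        rw [hσσ, ← neg_sub n, hn, map_neg]; abel, (hσx n).2 hyn⟩
      have hsing : G (n + n₀) = {x} := by
        have hx₀ : x ∈ G n₀ := by simp [hn₀]
        refine Finset.eq_singleton_iff_unique_mem.2 ⟨h.mem_add hxn hx₀, fun z hz => ?_⟩
        have := h.mem_and_mem_of_mem_add hxn hx₀ hz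
        rw [hn₀, Finset.mem_insert, Finset.mem_singleton] at this
        rcases this.2 with rfl | rfl
        · rfl
        · exact absurd this.1 hyn
      obtain ⟨j, -, hj⟩ := h.continuous _ x hsing (-a)
      refine ⟨j, _, ?_, (by rw [hj]; simp : x ∈ G (j • (n + n₀) + -a))⟩
      have e : j • (n - σ n) = j • (b - σ b) := by rw [hn]
      simp only [smul_sub] at e
      simp only [map_add, map_nsmul, map_neg, map_sub, hσ₀, smul_add]
      have e2 : j • n = j • b - j • σ b + j • σ n := by rw [← e]; abel
      rw [e2]
      abel)
  refine ⟨φ, fun n hn => (hφ n).1 ⟨n, rfl, hn⟩, fun n hn hyn => ?_, fun n => ?_⟩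
  -- Otherwise `-n` has a witness `n'`. Then `n + n'` is swap-invariant and chooses `x`, hence also
  -- `y`, and consistency puts `y` into `G n`.
  · by_contra hle
    rw [not_lt, ← neg_nonneg, ← map_neg, ← hφ] at hle
    obtain ⟨n', hn', hxn'⟩ := hle
    refine hyn (h.mem_and_mem_of_mem_add hn hxn' ?_).1
    have : σ (n + n') = n + n' := by
      rw [map_neg] at hn'
      rw [map_add, ← sub_eq_zero]
      calc σ n + σ n' - (n + n') = -(n' - σ n') + (-n - -σ n) := by abel
        _ = 0 := by rw [hn', neg_add_cancel]
    rw [← this, hσy]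
    exact h.mem_add hn hxn'
  -- Swap-invariant vectors lie in the cone together with their negatives, so the functional
  -- vanishes on them, in particular on `n + σ n`.
  · have h1 : ∀ m, σ m = m → 0 ≤ φ m := fun m hm =>
      (hφ m).1 ⟨0, by rw [hm, map_zero, sub_self, sub_self], h.zero x hx⟩
    have hinv : σ (n + σ n) = n + σ n := by rw [map_add, hσσ, add_comm]
    have h2 := h1 _ hinv
    have h3 := h1 (-(n + σ n)) (by rw [map_neg, hinv])
    rw [map_neg, map_add] at h3
    rw [map_add] at h2
    linarith

end IsConsistentChoice

/-! ### From functionals to weighted numbers of approvals. -/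

/-- Two subsets of `U` of equal size are related by a permutation that fixes everything outside
`U`. -/
theorem Finset.exists_perm_map_eq_of_subset {C : Type*} [DecidableEq C] {s t U : Finset C}
    (hs : s ⊆ U) (ht : t ⊆ U) (h : s.card = t.card) :
    ∃ τ : Equiv.Perm C, s.map τ.toEmbedding = t ∧ ∀ c, c ∉ U → τ c = c := by
  obtain ⟨σ, hσ⟩ := Equiv.Perm.exists_map_finset_eq (β := U) (s.subtype (· ∈ U))
    (t.subtype (· ∈ U)) (by
      rw [Finset.card_subtype, Finset.card_subtype, Finset.filter_true_of_mem fun x hx => hs hx,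
        Finset.filter_true_of_mem fun x hx => ht hx, h])
  refine ⟨Equiv.Perm.ofSubtype σ, ?_, fun c hc => Equiv.Perm.ofSubtype_apply_of_not_mem σ hc⟩
  refine Finset.eq_of_subset_of_card_le (fun b hb => ?_) (by simp [h])
  obtain ⟨a, ha, rfl⟩ := Finset.mem_map.1 hb
  have : σ ⟨a, hs ha⟩ ∈ t.subtype (· ∈ U) := by
    rw [← hσ]
    exact Finset.mem_map_of_mem _ (Finset.mem_subtype.2 ha)
  rw [Equiv.coe_toEmbedding, Equiv.Perm.ofSubtype_apply_of_mem σ (hs ha)]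
  exact Finset.mem_subtype.1 this

theorem permVec_single {C : Type*} [DecidableEq C] (τ : Equiv.Perm C) (B : Ballot C) :
    permVec τ (Pi.single B 1) = Pi.single (Ballot.perm τ B) 1 := by
  funext D
  simp only [permVec_apply, Pi.single_apply, Equiv.symm_apply_eq]

theorem Finset.map_perm_mul {C : Type*} (σ τ : Equiv.Perm C) (s : Finset C) :
    s.map (σ * τ).toEmbedding = (s.map τ.toEmbedding).map σ.toEmbedding := by
  rw [Finset.map_map]
  rfl

section weightedApproval

variable {C : Type*} [Fintype C] [DecidableEq C]

/-- The number of approvals of `z`, where a voter has weight `d a b` if she approves `a` candidates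
in `W` and `b` candidates outside `W`. -/
noncomputable def weightedApproval (d : ℕ → ℕ → ℝ) (W : Finset C) (z : C) (n : Ballot C → ℤ) : ℝ :=
  ∑ B : Ballot C, n B * if z ∈ B.1 then d (B.1 ∩ W).card (B.1 \ W).card else 0

theorem weightedApproval_permVec (d : ℕ → ℕ → ℝ) (W : Finset C) (z : C) (n : Ballot C → ℤ)
    (τ : Equiv.Perm C) :
    weightedApproval d (W.map τ.toEmbedding) (τ z) (permVec τ n) = weightedApproval d W z n := by
  rw [weightedApproval, ← Equiv.sum_comp (Ballot.perm τ)]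
  refine Finset.sum_congr rfl fun B _ => ?_
  rw [permVec_apply, Equiv.symm_apply_apply, Ballot.perm_coe, ← Finset.map_inter,
    ← Finset.map_sdiff, Finset.card_map, Finset.card_map]
  simp

end weightedApproval

namespace IsConsistentChoice

variable {C : Type*} [Fintype C] [DecidableEq C] {W : Finset C} {G : (Ballot C → ℤ) → Finset C}

/-- A functional that compares `x` and `y` and is invariant under all permutations that stabilize
`W` and fix `x` and `y`. -/
theorem exists_invariant_functional (h : IsConsistentChoice W G) {x y : C} (hx : x ∉ W)
    (hy : y ∉ W) (hxy : x ≠ y) :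
    ∃ φ : (Ballot C → ℤ) →+ ℝ, (∀ n, x ∈ G n → 0 ≤ φ n) ∧ (∀ n, x ∈ G n → y ∉ G n → 0 < φ n) ∧
      (∀ n, φ (permVec (Equiv.swap x y) n) = -φ n) ∧
      ∀ τ : Equiv.Perm C, W.map τ.toEmbedding = W → τ x = x → τ y = y →
        ∀ n, φ (permVec τ n) = φ n := by
  classical
  obtain ⟨φ, h1, h2, h3⟩ := h.exists_functional hx hy hxy
  let H : Finset (Equiv.Perm C) :=
    Finset.univ.filter fun τ => W.map τ.toEmbedding = W ∧ τ x = x ∧ τ y = y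
  have hH : ∀ τ, τ ∈ H ↔ W.map τ.toEmbedding = W ∧ τ x = x ∧ τ y = y := fun τ => by simp [H]
  have h1H : (1 : Equiv.Perm C) ∈ H := (hH 1).2 ⟨Finset.map_refl, rfl, rfl⟩
  let Φ : (Ballot C → ℤ) →+ ℝ := ∑ τ ∈ H, φ.comp (permVec τ)
  have hΦ : ∀ n, Φ n = ∑ τ ∈ H, φ (permVec τ n) := fun n => by simp [Φ]
  refine ⟨Φ, fun n hn => ?_, fun n hn hyn => ?_, fun n => ?_, fun τ hτW hτx hτy n => ?_⟩
  · rw [hΦ]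
    refine Finset.sum_nonneg fun τ hτ => h1 _ ?_
    obtain ⟨hτW, hτx, -⟩ := (hH τ).1 hτ
    rw [← hτx, h.mem_permVec hτW]
    exact hn
  · rw [hΦ]
    refine Finset.sum_pos (fun τ hτ => h2 _ ?_ ?_) ⟨1, h1H⟩
    · obtain ⟨hτW, hτx, -⟩ := (hH τ).1 hτ
      rw [← hτx, h.mem_permVec hτW]
      exact hn
    · obtain ⟨hτW, -, hτy⟩ := (hH τ).1 hτ
      rw [← hτy, h.mem_permVec hτW]
      exact hyn
  · rw [hΦ, hΦ, ← Finset.sum_neg_distrib]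
    refine Finset.sum_congr rfl fun τ hτ => ?_
    obtain ⟨-, hτx, hτy⟩ := (hH τ).1 hτ
    rw [← h3, permVec_permVec, permVec_permVec]
    congr 2
    -- Averaging keeps the antisymmetry because permutations that fix `x` and `y` commute with their
    -- swap.
    rw [Equiv.mul_swap_eq_swap_mul, hτx, hτy]
  · rw [hΦ, hΦ]
    simp only [permVec_permVec]
    refine Finset.sum_nbij' (fun σ => σ * τ) (fun σ => σ * τ⁻¹) (fun σ hσ => ?_) (fun σ hσ => ?_)
      (fun σ _ => mul_inv_cancel_right σ τ) (fun σ _ => inv_mul_cancel_right σ τ) fun σ _ => rfl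
    · obtain ⟨hσW, hσx, hσy⟩ := (hH σ).1 hσ
      refine (hH _).2 ⟨?_, ?_, ?_⟩
      · rw [Finset.map_perm_mul, hτW, hσW]
      · rw [Equiv.Perm.mul_apply, hτx, hσx]
      · rw [Equiv.Perm.mul_apply, hτy, hσy]
    · obtain ⟨hσW, hσx, hσy⟩ := (hH σ).1 hσ
      refine (hH _).2 ⟨?_, ?_, ?_⟩
      · rw [Finset.map_perm_mul]
        nth_rw 1 [← hτW]
        rw [← Finset.map_perm_mul τ⁻¹, inv_mul_cancel]
        exact (congrArg _ Finset.map_refl).trans hσW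
      · rw [Equiv.Perm.mul_apply, Equiv.Perm.inv_eq_iff_eq.2 hτx.symm, hσx]
      · rw [Equiv.Perm.mul_apply, Equiv.Perm.inv_eq_iff_eq.2 hτy.symm, hσy]

/-- Two ballots that contain `x` but not `y` and intersect both `W` and its complement in equally
many candidates are related by a permutation that stabilizes `W` and fixes `x` and `y`. -/
theorem exists_perm_ballot_eq {x y : C} (hx : x ∉ W) (hy : y ∉ W) {B B' : Ballot C}
    (hxB : x ∈ B.1) (hyB : y ∉ B.1) (hxB' : x ∈ B'.1) (hyB' : y ∉ B'.1)
    (h1 : (B.1 ∩ W).card = (B'.1 ∩ W).card) (h2 : (B.1 \ W).card = (B'.1 \ W).card) :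
    ∃ τ : Equiv.Perm C, W.map τ.toEmbedding = W ∧ τ x = x ∧ τ y = y ∧ Ballot.perm τ B = B' := by
  obtain ⟨σ, hσ, hσW⟩ := Finset.exists_perm_map_eq_of_subset (U := W) Finset.inter_subset_right
    Finset.inter_subset_right h1
  obtain ⟨ρ, hρ, hρW⟩ := Finset.exists_perm_map_eq_of_subset (U := (Wᶜ.erase x).erase y)
    (s := (B.1 \ W).erase x) (t := (B'.1 \ W).erase x)
    (fun c hc => by
      simp only [Finset.mem_erase, Finset.mem_sdiff, Finset.mem_compl] at hc ⊢
      exact ⟨fun e => hyB (e ▸ hc.2.1), hc.1, hc.2.2⟩)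
    (fun c hc => by
      simp only [Finset.mem_erase, Finset.mem_sdiff, Finset.mem_compl] at hc ⊢
      exact ⟨fun e => hyB' (e ▸ hc.2.1), hc.1, hc.2.2⟩)
    (by
      rw [Finset.card_erase_of_mem (Finset.mem_sdiff.2 ⟨hxB, hx⟩),
        Finset.card_erase_of_mem (Finset.mem_sdiff.2 ⟨hxB', hx⟩), h2])
  have hρx : ρ x = x := hρW x (by simp)
  have hρy : ρ y = y := hρW y (by simp)
  have hρw : ∀ w ∈ W, ρ w = w := fun w hw => hρW w (by simp [hw])
  have hσx : σ x = x := hσW x hx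
  have hσy : σ y = y := hσW y hy
  have hfix : ∀ (τ : Equiv.Perm C) (s : Finset C), (∀ c ∈ s, τ c = c) →
      s.map τ.toEmbedding = s := fun τ s hs => by
    refine Finset.eq_of_subset_of_card_le (fun w hw => ?_) (Finset.card_map _).ge
    obtain ⟨v, hv, rfl⟩ := Finset.mem_map.1 hw
    rw [Equiv.coe_toEmbedding, hs v hv]
    exact hv
  have hσWW : W.map σ.toEmbedding = W := by
    refine Finset.eq_of_subset_of_card_le (fun w hw => ?_) (Finset.card_map _).ge
    obtain ⟨v, hv, rfl⟩ := Finset.mem_map.1 hw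
    by_contra hc
    have := hσW _ hc
    rw [Equiv.coe_toEmbedding, σ.injective.eq_iff] at this
    rw [Equiv.coe_toEmbedding, this] at hc
    exact hc hv
  -- `σ` rearranges `W`, and `ρ` rearranges the candidates outside `W` other than `x` and `y`.
  refine ⟨ρ * σ, ?_, ?_, ?_, ?_⟩
  · rw [Finset.map_perm_mul, hσWW, hfix ρ W hρw]
  · rw [Equiv.Perm.mul_apply, hσx, hρx]
  · rw [Equiv.Perm.mul_apply, hσy, hρy]
  · have key : ∀ B : Ballot C, x ∈ B.1 → B.1 = (B.1 ∩ W) ∪ insert x ((B.1 \ W).erase x) := by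
      intro B hB
      rw [Finset.insert_erase (Finset.mem_sdiff.2 ⟨hB, hx⟩), Finset.union_comm,
        Finset.sdiff_union_inter]
    ext1
    rw [Ballot.perm_coe, key B hxB, key B' hxB', Finset.map_perm_mul, Finset.map_union,
      Finset.map_union, hσ, hfix ρ _ fun c hc => hρw c (Finset.mem_inter.1 hc).2,
      hfix σ (insert x _) fun c hc => hσW c ?_, Finset.map_insert, hρ, Equiv.coe_toEmbedding, hρx]
    rw [Finset.insert_erase (Finset.mem_sdiff.2 ⟨hxB, hx⟩)] at hc
    exact (Finset.mem_sdiff.1 hc).2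

/-- The invariant functional is determined by its values on single ballots. Ballots with both or
neither of `x`, `y` are fixed by the swap and get 0; those with only `y` get the negative of their
swapped ballot; those with only `x` are classified by two cardinalities. So the functional is a
difference of two weighted approvals. -/
theorem exists_weight (h : IsConsistentChoice W G) {x y : C} (hx : x ∉ W) (hy : y ∉ W)
    (hxy : x ≠ y) :
    ∃ d : ℕ → ℕ → ℝ,
      (∀ n, x ∈ G n → weightedApproval d W y n ≤ weightedApproval d W x n) ∧
      ∀ n, x ∈ G n → y ∉ G n → weightedApproval d W y n < weightedApproval d W x n := by
  classical
  obtain ⟨φ, h1, h2, h3, h4⟩ := h.exists_invariant_functional hx hy hxy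
  let P : ℕ → ℕ → Ballot C → Prop := fun a b B =>
    x ∈ B.1 ∧ y ∉ B.1 ∧ (B.1 ∩ W).card = a ∧ (B.1 \ W).card = b
  let c : Ballot C → ℝ := fun B => φ (Pi.single B 1)
  -- Sizes that no ballot with `x` and without `y` attains get weight 0; any value would do, since
  -- ballots with both candidates cancel in the difference.
  let d : ℕ → ℕ → ℝ := fun a b => if e : ∃ B, P a b B then c e.choose else 0
  have hd : ∀ B : Ballot C, x ∈ B.1 → y ∉ B.1 → c B = d (B.1 ∩ W).card (B.1 \ W).card := by
    intro B hxB hyB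
    have e : ∃ B', P (B.1 ∩ W).card (B.1 \ W).card B' := ⟨B, hxB, hyB, rfl, rfl⟩
    simp only [d, e, dite_true]
    obtain ⟨e1, e2, e3, e4⟩ := e.choose_spec
    obtain ⟨τ, t1, t2, t3, t4⟩ := exists_perm_ballot_eq hx hy hxB hyB e1 e2 e3.symm e4.symm
    rw [← t4]
    simp only [c]
    rw [← permVec_single, h4 τ t1 t2 t3]
  have hswap : ∀ B, c (Ballot.perm (Equiv.swap x y) B) = -c B := fun B => by
    simp only [c]
    rw [← permVec_single, h3]
  have hW : W.map (Equiv.swap x y).toEmbedding = W := Finset.map_swap_eq_self hx hy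
  have hc : ∀ B : Ballot C, c B =
      (if x ∈ B.1 then d (B.1 ∩ W).card (B.1 \ W).card else 0) -
        if y ∈ B.1 then d (B.1 ∩ W).card (B.1 \ W).card else 0 := by
    intro B
    have hfix : (x ∈ B.1 ↔ y ∈ B.1) → c B = 0 := by
      intro hiff
      have : Ballot.perm (Equiv.swap x y) B = B := by
        ext1
        rw [Ballot.perm_coe]
        refine Finset.eq_of_subset_of_card_le (fun w hw => ?_) (Finset.card_map _).ge
        obtain ⟨v, hv, rfl⟩ := Finset.mem_map.1 hw
        rw [Equiv.coe_toEmbedding, Equiv.swap_apply_def]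
        split_ifs with e1 e2
        · exact hiff.1 (e1 ▸ hv)
        · exact hiff.2 (e2 ▸ hv)
        · exact hv
      have := (congrArg c this).symm.trans (hswap B)
      linarith
    by_cases hxB : x ∈ B.1 <;> by_cases hyB : y ∈ B.1
    · simp [hxB, hyB, hfix]
    · simp [hxB, hyB, hd]
    · have e1 : x ∈ (Ballot.perm (Equiv.swap x y) B).1 := by
        rw [Ballot.perm_coe, Finset.mem_map_equiv, Equiv.symm_swap, Equiv.swap_apply_left]
        exact hyB
      have e2 : y ∉ (Ballot.perm (Equiv.swap x y) B).1 := by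
        rw [Ballot.perm_coe, Finset.mem_map_equiv, Equiv.symm_swap, Equiv.swap_apply_right]
        exact hxB
      have e3 := hd _ e1 e2
      rw [hswap, Ballot.perm_coe] at e3
      rw [← hW, ← Finset.map_inter, ← Finset.map_sdiff, Finset.card_map, Finset.card_map] at e3
      simp only [hxB, hyB, if_true, if_false, zero_sub]
      linarith
    · simp [hxB, hyB, hfix]
  have hφ : ∀ n, φ n = weightedApproval d W x n - weightedApproval d W y n := by
    intro n
    have : n = ∑ B, n B • Pi.single B (1 : ℤ) := by
      funext D
      simp [Finset.sum_apply, Pi.single_apply]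
    conv_lhs => rw [this]
    rw [map_sum, weightedApproval, weightedApproval, ← Finset.sum_sub_distrib]
    refine Finset.sum_congr rfl fun B _ => ?_
    rw [map_zsmul, zsmul_eq_mul, ← mul_sub, ← hc]
  refine ⟨d, fun n hn => ?_, fun n hn hyn => ?_⟩
  · have := h1 n hn
    rw [hφ] at this
    linarith
  · have := h2 n hn hyn
    rw [hφ] at this
    linarith

/-- Consistent choices maximize a weighted number of approvals. -/
theorem exists_weight_mem_iff (h : IsConsistentChoice W G) (hW : 2 ≤ Wᶜ.card) :
    ∃ d : ℕ → ℕ → ℝ, (∃ a b, a ≤ W.card ∧ 1 ≤ b ∧ b < Wᶜ.card ∧ d a b ≠ 0) ∧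
      ∀ n z, z ∈ G n ↔
        z ∉ W ∧ ∀ w, w ∉ W → weightedApproval d W w n ≤ weightedApproval d W z n := by
  obtain ⟨x, hx, y, hy, hxy⟩ := Finset.one_lt_card.1 hW
  rw [Finset.mem_compl] at hx hy
  obtain ⟨d, h1, h2⟩ := h.exists_weight hx hy hxy
  -- The stabilizer of `W` acts transitively on ordered pairs outside `W`, so the weights found for
  -- `x` and `y` serve for every pair.
  have htr : ∀ z w, z ∉ W → w ∉ W → z ≠ w → ∃ τ : Equiv.Perm C, W.map τ.toEmbedding = W ∧
      τ z = x ∧ τ w = y := by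
    intro z w hz hw hzw
    have hw' : Equiv.swap z x w ∉ W := fun hc => by
      rw [← Finset.map_swap_eq_self hz hx, Finset.mem_map_equiv, Equiv.symm_swap,
        Equiv.swap_apply_self] at hc
      exact hw hc
    have hne : x ≠ Equiv.swap z x w := fun hc => by
      exact hzw ((Equiv.swap z x).injective ((Equiv.swap_apply_left z x).trans hc))
    refine ⟨Equiv.swap (Equiv.swap z x w) y * Equiv.swap z x, ?_, ?_, ?_⟩
    · rw [Finset.map_perm_mul, Finset.map_swap_eq_self hz hx, Finset.map_swap_eq_self hw' hy]
    · rw [Equiv.Perm.mul_apply, Equiv.swap_apply_left, Equiv.swap_apply_of_ne_of_ne hne hxy]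
    · rw [Equiv.Perm.mul_apply, Equiv.swap_apply_left]
  have hwa : ∀ (τ : Equiv.Perm C), W.map τ.toEmbedding = W → ∀ z n,
      weightedApproval d W (τ z) (permVec τ n) = weightedApproval d W z n := fun τ hτ z n => by
    have := weightedApproval_permVec d W z n τ
    rwa [hτ] at this
  have hle : ∀ n z w, z ∈ G n → w ∉ W → weightedApproval d W w n ≤ weightedApproval d W z n := by
    intro n z w hz hw
    rcases eq_or_ne z w with rfl | hzw
    · exact le_rfl
    obtain ⟨τ, hτ, rfl, rfl⟩ := htr z w (h.notMem n z hz) hw hzw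
    rw [← hwa τ hτ w n, ← hwa τ hτ z n]
    exact h1 _ ((h.mem_permVec hτ).2 hz)
  have hlt : ∀ n z w, z ∈ G n → w ∉ W → w ∉ G n →
      weightedApproval d W w n < weightedApproval d W z n := by
    intro n z w hz hw hwn
    have hzw : z ≠ w := fun e => hwn (e ▸ hz)
    obtain ⟨τ, hτ, rfl, rfl⟩ := htr z w (h.notMem n z hz) hw hzw
    rw [← hwa τ hτ w n, ← hwa τ hτ z n]
    exact h2 _ ((h.mem_permVec hτ).2 hz) fun hc => hwn ((h.mem_permVec hτ).1 hc)
  refine ⟨d, ?_, fun n z => ⟨fun hz => ⟨h.notMem n z hz, fun w hw => hle n z w hz hw⟩, ?_⟩⟩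
  -- If all these weights vanish, only ballots containing all of `Wᶜ` count, and they treat all
  -- candidates outside `W` alike. Then no single-valued choice could occur.
  · by_contra hno
    push Not at hno
    obtain ⟨n, z, hn⟩ := h.exists_singleton
    have hz : z ∈ G n := by simp [hn]
    have hzW := h.notMem n z hz
    obtain ⟨w, hw, hwz⟩ := Finset.exists_mem_ne hW z
    rw [Finset.mem_compl] at hw
    refine (hlt n z w hz hw (by simpa [hn] using hwz)).not_ge (le_of_eq ?_)
    refine Finset.sum_congr rfl fun B _ => ?_
    congr 1
    by_cases hB : Wᶜ ⊆ B.1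
    · rw [if_pos (hB (Finset.mem_compl.2 hw)), if_pos (hB (Finset.mem_compl.2 hzW))]
    · by_cases hB' : (B.1 \ W) = ∅
      · have hno' : ∀ v, v ∉ W → v ∉ B.1 := fun v hv hvB => by
          have : v ∈ B.1 \ W := Finset.mem_sdiff.2 ⟨hvB, hv⟩
          simp [hB'] at this
        rw [if_neg (hno' w hw), if_neg (hno' z hzW)]
      · rw [hno _ _ (Finset.card_le_card Finset.inter_subset_right)
          (Finset.card_pos.2 (Finset.nonempty_iff_ne_empty.2 hB')), ite_self, ite_self]
        refine Finset.card_lt_card ⟨fun v hv => ?_, fun hc => hB fun v hv => ?_⟩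
        · exact Finset.mem_compl.2 (Finset.mem_sdiff.1 hv).2
        · exact (Finset.mem_sdiff.1 (hc hv)).1
  · rintro ⟨hz, hmax⟩
    obtain ⟨w, hw⟩ := h.nonempty n
    by_contra hzn
    exact (hlt n w z hw hz hzn).not_ge (hmax w (h.notMem n w hw))

end IsConsistentChoice

/-! ### The voting rule as a function of multiplicity vectors. -/

theorem ApprovalProfile.count_pos {C : Type*} [DecidableEq C] (A : ApprovalProfile C) :
    0 < A.count :=
  lt_of_le_of_ne A.count_nonneg A.count_ne_zero.symm

theorem permVec_pos {C : Type*} (τ : Equiv.Perm C) {n : Ballot C → ℤ} (hn : 0 < n) :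
    0 < permVec τ n := by
  refine lt_of_le_of_ne (fun B => hn.le _) fun h => hn.ne' (funext fun B => ?_)
  have := congrFun h (Ballot.perm τ B)
  rw [permVec_apply, Equiv.symm_apply_apply] at this
  exact this.symm

theorem Function.exists_nsmul_pos {ι : Type*} [Finite ι] [Nonempty ι] {e : ι → ℤ} (he : 1 ≤ e)
    (n : ι → ℤ) : ∃ J : ℕ, 0 < n + J • e := by
  cases nonempty_fintype ι
  refine ⟨∑ i, (n i).natAbs + 1, ?_⟩
  have key : ∀ i, 0 < (n + (∑ i, (n i).natAbs + 1) • e) i := fun i => by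
    have h1 : (n i).natAbs ≤ ∑ i, (n i).natAbs :=
      Finset.single_le_sum (f := fun i => (n i).natAbs) (fun _ _ => Nat.zero_le _)
        (Finset.mem_univ i)
    have h2 : (1 : ℤ) ≤ e i := he i
    have h3 : ((∑ i, (n i).natAbs + 1 : ℕ) : ℤ) ≤ (∑ i, (n i).natAbs + 1 : ℕ) * e i :=
      le_mul_of_one_le_right (Int.natCast_nonneg _) h2
    rw [Pi.add_apply, Pi.smul_apply, nsmul_eq_mul]
    omega
  refine lt_of_le_of_ne (fun i => (key i).le) fun h => ?_
  have := key (Classical.arbitrary ι)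
  rw [← h] at this
  exact lt_irrefl _ this

theorem ABCVotingRule.winners_zero {C : Type*} [Fintype C] (f : ABCVotingRule C) (A : ApprovalProfile C) : f.winners A 0 = {∅} := by
  refine Finset.eq_singleton_iff_nonempty_unique_mem.2 ⟨f.nonempty A 0 (Nat.zero_le _), ?_⟩
  intro W hW
  exact Finset.card_eq_zero.1 (f.card_eq A 0 W hW)

namespace ABCVotingRule

variable {C : Type*} [Fintype C] [DecidableEq C]

open Classical in
/-- The winning committees for a vector of ballot multiplicities. -/
noncomputable def vecWinners (f : ABCVotingRule C) (n : Ballot C → ℤ) (k : ℕ) :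
    Finset (Finset C) :=
  if h : ∃ A : ApprovalProfile C, A.count = n then f.winners h.choose k else ∅

theorem vecWinners_count {f : ABCVotingRule C} (ha : f.IsAnonymous) (A : ApprovalProfile C) {k : ℕ}
    (hk : k ≤ Fintype.card C) : f.vecWinners A.count k = f.winners A k := by
  have h : ∃ A' : ApprovalProfile C, A'.count = A.count := ⟨A, rfl⟩
  rw [vecWinners, dif_pos h]
  obtain ⟨π, hπ⟩ := ApprovalProfile.exists_permuteVoters_eq h.choose_spec
  rw [ha _ k hk π, hπ]

/-- The candidates that extend `W` to a winning committee. -/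
noncomputable def vecExtend (f : ABCVotingRule C) (n : Ballot C → ℤ) (W : Finset C) : Finset C :=
  Finset.univ.filter fun x => x ∉ W ∧ insert x W ∈ f.vecWinners n (W.card + 1)

theorem mem_vecExtend {f : ABCVotingRule C} {n : Ballot C → ℤ} {W : Finset C} {x : C} :
    x ∈ f.vecExtend n W ↔ x ∉ W ∧ insert x W ∈ f.vecWinners n (W.card + 1) := by
  simp [vecExtend]

theorem vecWinners_perm {f : ABCVotingRule C} (ha : f.IsAnonymous) (hn : f.IsNeutral)
    {n : Ballot C → ℤ} (hpos : 0 < n) {k : ℕ} (hk : k ≤ Fintype.card C) (τ : Equiv.Perm C) :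
    f.vecWinners (permVec τ n) k = (f.vecWinners n k).image fun W => W.map τ.toEmbedding := by
  obtain ⟨A, rfl, -⟩ := ApprovalProfile.exists_count_eq hpos.le hpos.ne' ∅
  have : permVec τ A.count = (A.permuteCandidates τ).count := (A.count_permuteCandidates τ).symm
  rw [this, vecWinners_count ha _ hk, vecWinners_count ha _ hk]
  ext V
  have := Set.ext_iff.1 (hn A k hk τ) V
  rw [Finset.mem_coe] at this
  rw [this, Finset.mem_image]
  simp only [Set.mem_ofPred_eq, eq_comm]

theorem vecExtend_perm {f : ABCVotingRule C} (ha : f.IsAnonymous) (hn : f.IsNeutral)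
    {n : Ballot C → ℤ} (hpos : 0 < n) {W : Finset C} (hW : W.card < Fintype.card C)
    (τ : Equiv.Perm C) :
    f.vecExtend (permVec τ n) (W.map τ.toEmbedding) = (f.vecExtend n W).map τ.toEmbedding := by
  ext y
  obtain ⟨x, rfl⟩ := τ.surjective y
  have h1 : τ x ∈ W.map τ.toEmbedding ↔ x ∈ W := Finset.mem_map' _
  have h2 : τ x ∈ (f.vecExtend n W).map τ.toEmbedding ↔ x ∈ f.vecExtend n W := Finset.mem_map' _
  have h3 : insert (τ x) (W.map τ.toEmbedding) = (insert x W).map τ.toEmbedding :=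
    (Finset.map_insert _ _ _).symm
  rw [h2, mem_vecExtend, mem_vecExtend, h1, h3, Finset.card_map, vecWinners_perm ha hn hpos hW,
    Finset.mem_image]
  refine and_congr_right fun _ => ⟨?_, fun h => ⟨_, h, rfl⟩⟩
  rintro ⟨V, hV, e⟩
  rwa [← Finset.map_injective _ e]

theorem exists_vecWinners_add_eq {f : ABCVotingRule C} (ha : f.IsAnonymous) (hc : f.IsContinuous)
    {n n' : Ballot C → ℤ} (hn : 0 < n) (hn' : 0 < n') {k : ℕ} (hk : k ≤ Fintype.card C)
    {W : Finset C} (hW : f.vecWinners n k = {W}) :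
    ∃ j : ℕ, 1 ≤ j ∧ f.vecWinners (j • n + n') k = {W} := by
  obtain ⟨A, rfl, -⟩ := ApprovalProfile.exists_count_eq hn.le hn.ne' ∅
  obtain ⟨A', rfl, hd⟩ := ApprovalProfile.exists_count_eq hn'.le hn'.ne' A.electorate
  rw [vecWinners_count ha _ hk] at hW
  obtain ⟨j, hj, h⟩ := hc A A' hd.symm k hk (by rw [hW, Finset.card_singleton])
  obtain ⟨B, hB, hBd⟩ := A.exists_isCopies hj A'.electorate
  refine ⟨j, hj, ?_⟩
  rw [← ApprovalProfile.count_of_isCopies hB, ← ApprovalProfile.count_add hBd,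
    vecWinners_count ha _ hk, h B hB hBd, hW]

variable {f : ABCVotingRule C} {g : GeneratorFunction C}

/-- Uniqueness of `W` is essential: with several winners, `insert x W` may also win as an extension
of another committee. -/
theorem extend_eq_vecExtend (ha : f.IsAnonymous) (hfg : f.IsGeneratedBy g) {A : ApprovalProfile C}
    {W : Finset C} (hW : W.card < Fintype.card C) (h : f.winners A W.card = {W}) :
    g.extend A W = f.vecExtend A.count W := by
  obtain ⟨-, h2⟩ := hfg A W.card hW
  ext x
  rw [mem_vecExtend, vecWinners_count ha _ hW, ← Finset.mem_coe (a := insert x W), h2]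
  simp only [h, Finset.mem_singleton, exists_eq_left, Set.mem_ofPred_eq]
  constructor
  · exact fun hx => ⟨g.notMem _ _ _ hx, x, hx, rfl⟩
  · rintro ⟨hx, y, hy, e⟩
    have : x ∈ insert y W := e ▸ Finset.mem_insert_self x W
    rcases Finset.mem_insert.1 this with rfl | h
    · exact hy
    · exact absurd h hx

theorem vecExtend_nonempty (ha : f.IsAnonymous) (hfg : f.IsGeneratedBy g) {n : Ballot C → ℤ}
    (hn : 0 < n) {W : Finset C} (hW : W.card < Fintype.card C)
    (h : f.vecWinners n W.card = {W}) : (f.vecExtend n W).Nonempty := by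
  obtain ⟨A, rfl, -⟩ := ApprovalProfile.exists_count_eq hn.le hn.ne' ∅
  rw [vecWinners_count ha _ hW.le] at h
  rw [← extend_eq_vecExtend ha hfg hW h]
  exact (hfg A W.card hW).1 W (by simp [h])

theorem vecWinners_succ (ha : f.IsAnonymous) (hfg : f.IsGeneratedBy g) {n : Ballot C → ℤ}
    (hn : 0 < n) {W : Finset C} (hW : W.card < Fintype.card C)
    (h : f.vecWinners n W.card = {W}) :
    f.vecWinners n (W.card + 1) = (f.vecExtend n W).image fun x => insert x W := by
  obtain ⟨A, rfl, -⟩ := ApprovalProfile.exists_count_eq hn.le hn.ne' ∅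
  rw [vecWinners_count ha _ hW.le] at h
  rw [← extend_eq_vecExtend ha hfg hW h, vecWinners_count ha _ hW]
  ext V
  rw [← Finset.mem_coe, (hfg A W.card hW).2]
  simp [h, eq_comm]

theorem vecExtend_add (ha : f.IsAnonymous) (hg : g.IsConsistent) (hfg : f.IsGeneratedBy g)
    {n n' : Ballot C → ℤ} (hn : 0 < n) (hn' : 0 < n') {W : Finset C}
    (hW : W.card < Fintype.card C) (h : f.vecWinners n W.card = {W})
    (h' : f.vecWinners n' W.card = {W}) (hadd : f.vecWinners (n + n') W.card = {W})
    (hne : (f.vecExtend n W ∩ f.vecExtend n' W).Nonempty) :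
    f.vecExtend (n + n') W = f.vecExtend n W ∩ f.vecExtend n' W := by
  have hne' := vecExtend_nonempty ha hfg (add_pos hn hn') hW hadd
  obtain ⟨A, rfl, -⟩ := ApprovalProfile.exists_count_eq hn.le hn.ne' ∅
  obtain ⟨A', rfl, hd⟩ := ApprovalProfile.exists_count_eq hn'.le hn'.ne' A.electorate
  rw [← ApprovalProfile.count_add hd.symm] at hadd hne' ⊢
  rw [vecWinners_count ha _ hW.le] at h h' hadd
  rw [← extend_eq_vecExtend ha hfg hW h, ← extend_eq_vecExtend ha hfg hW h'] at hne ⊢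
  rw [← extend_eq_vecExtend ha hfg hW hadd] at hne' ⊢
  exact hg A A' hd.symm W (fun e => by simp [e] at hW) hne hne'

/-- Here `W` may be tied with other winners at `A`. Adding `e` removes this tie, and since `e`
admits every candidate outside `W`, consistency leaves the generator at `W` unchanged. -/
theorem extend_eq_vecExtend_add (ha : f.IsAnonymous) (hg : g.IsConsistent)
    (hfg : f.IsGeneratedBy g) {A : ApprovalProfile C} {e : Ballot C → ℤ} (he : 0 < e)
    {W : Finset C} (hW : W.card < Fintype.card C) (h : W ∈ f.winners A W.card)
    (he' : f.vecWinners e W.card = {W}) (hadd : f.vecWinners (A.count + e) W.card = {W})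
    (hext : f.vecExtend e W = Wᶜ) : g.extend A W = f.vecExtend (A.count + e) W := by
  have hne' := vecExtend_nonempty ha hfg (add_pos A.count_pos he) hW hadd
  obtain ⟨E, rfl, hd⟩ := ApprovalProfile.exists_count_eq he.le he.ne' A.electorate
  rw [← ApprovalProfile.count_add hd.symm] at hadd hne' ⊢
  rw [vecWinners_count ha _ hW.le] at he' hadd
  rw [← extend_eq_vecExtend ha hfg hW he'] at hext
  rw [← extend_eq_vecExtend ha hfg hW hadd] at hne' ⊢
  have hinter : g.extend A W ∩ g.extend E W = g.extend A W := by
    rw [hext, Finset.inter_eq_left]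
    exact fun x hx => Finset.mem_compl.2 (g.notMem A W x hx)
  rw [hg A E hd.symm W (fun e => by simp [e] at hW) _ hne', hinter]
  rw [hinter]
  exact (hfg A W.card hW).1 W h

/-- Take a profile with sole winner `insert y W`. It arises from some winner `V` by adding some `x`,
and a permutation carrying `V` to `W` and `x` to `y` preserves `insert y W`. After it, `W` is a
winner, perhaps among others, and only `y` can extend it. -/
theorem exists_extend_eq_singleton (hP : f.IsProper) (hfg : f.IsGeneratedBy g) {W : Finset C}
    {y : C} (hy : y ∉ W) :
    ∃ n : Ballot C → ℤ, 0 < n ∧ ∀ A : ApprovalProfile C, A.count = n →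
      W ∈ f.winners A W.card ∧ g.extend A W = {y} := by
  obtain ⟨ha, hn, -, hi⟩ := hP
  obtain ⟨D, hD⟩ := hi (insert y W)
  have hW : W.card < Fintype.card C := Finset.card_lt_univ_of_notMem hy
  rw [Finset.card_insert_of_notMem hy] at hD
  have hmem : insert y W ∈ (f.winners D (W.card + 1) : Set (Finset C)) := by simp [hD]
  rw [(hfg D W.card hW).2] at hmem
  obtain ⟨V, hV, x, hx, -⟩ := hmem
  have hxV := g.notMem _ _ _ hx
  obtain ⟨τ, hτ⟩ := Equiv.Perm.exists_map_finset_eq V W (f.card_eq _ _ _ hV)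
  have hτx : τ x ∉ W := by
    rw [← hτ]
    exact fun h => hxV ((Finset.mem_map' _).1 h)
  have hσ : V.map (Equiv.swap (τ x) y * τ).toEmbedding = W := by
    rw [Finset.map_perm_mul, hτ, Finset.map_swap_eq_self hτx hy]
  set σ := Equiv.swap (τ x) y * τ
  refine ⟨permVec σ D.count, permVec_pos σ D.count_pos, fun A hA => ?_⟩
  have hk : ∀ k, k ≤ Fintype.card C →
      f.winners A k = (f.winners D k).image fun W => W.map σ.toEmbedding := fun k hk => by
    rw [← vecWinners_count ha A hk, hA, vecWinners_perm ha hn D.count_pos hk,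
      vecWinners_count ha D hk]
  have hWA : W ∈ f.winners A W.card := by
    rw [hk _ hW.le]
    exact Finset.mem_image.2 ⟨V, hV, hσ⟩
  refine ⟨hWA, ?_⟩
  have hone : f.winners A (W.card + 1) = {insert y W} := by
    have h1 : insert x V = insert y W := by
      have : insert x V ∈ (f.winners D (W.card + 1) : Set (Finset C)) := by
        rw [(hfg D W.card hW).2]
        exact ⟨V, hV, x, hx, rfl⟩
      simpa [hD] using this
    have hσx : σ.toEmbedding x = y := Equiv.swap_apply_left _ _
    have h2 : (insert y W).map σ.toEmbedding = insert y W :=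
      calc (insert y W).map σ.toEmbedding = (insert x V).map σ.toEmbedding := by rw [h1]
        _ = insert y W := by rw [Finset.map_insert, hσ, hσx]
    rw [hk _ hW, hD, Finset.image_singleton, h2]
  obtain ⟨hne, heq⟩ := hfg A W.card hW
  refine Finset.eq_singleton_iff_nonempty_unique_mem.2 ⟨hne W hWA, fun z hz => ?_⟩
  have : insert z W ∈ (f.winners A (W.card + 1) : Set (Finset C)) := by
    rw [heq]
    exact ⟨W, hWA, z, hz, rfl⟩
  rw [hone, Finset.coe_singleton, Set.mem_singleton_iff] at this
  have hz' : z ∈ insert y W := this ▸ Finset.mem_insert_self z W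
  exact (Finset.mem_insert.1 hz').resolve_right (g.notMem _ _ _ hz)

/-! ### Vectors that follow a chain of committees without ties. -/

/-- The first `k + 1` sets of winning committees consist of the members of the sequence `c` only. -/
def Follows (f : ABCVotingRule C) (c : ℕ → Finset C) (k : ℕ) (n : Ballot C → ℤ) : Prop :=
  0 < n ∧ ∀ i ≤ k, f.vecWinners n i = {c i}

theorem Follows.mono {c : ℕ → Finset C} {k l : ℕ} {n : Ballot C → ℤ} (h : f.Follows c l n)
    (hkl : k ≤ l) : f.Follows c k n :=
  ⟨h.1, fun i hi => h.2 i (hi.trans hkl)⟩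

theorem vecWinners_zero {n : Ballot C → ℤ} (hn : 0 < n) : f.vecWinners n 0 = {∅} := by
  have h : ∃ A : ApprovalProfile C, A.count = n := by
    obtain ⟨A, hA, -⟩ := ApprovalProfile.exists_count_eq hn.le hn.ne' ∅
    exact ⟨A, hA⟩
  rw [vecWinners, dif_pos h, winners_zero]

theorem card_of_mem_vecWinners {n : Ballot C → ℤ} {k : ℕ} {W : Finset C}
    (hW : W ∈ f.vecWinners n k) : W.card = k := by
  rw [vecWinners] at hW
  split_ifs at hW with h
  · exact f.card_eq _ _ _ hW
  · simp at hW

theorem Follows.card {c : ℕ → Finset C} {k : ℕ} {n : Ballot C → ℤ} (h : f.Follows c k n) {i : ℕ}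
    (hi : i ≤ k) : (c i).card = i :=
  card_of_mem_vecWinners (f := f) (n := n) (by simp [h.2 i hi])

/-- A vector that follows a sequence extends each of its members in a unique way. -/
theorem Follows.exists_vecExtend_eq {c : ℕ → Finset C} {k : ℕ} {n : Ballot C → ℤ}
    (ha : f.IsAnonymous) (hfg : f.IsGeneratedBy g) (h : f.Follows c (k + 1) n)
    (hk : k + 1 ≤ Fintype.card C) :
    ∃ x, c (k + 1) = insert x (c k) ∧ x ∉ c k ∧ f.vecExtend n (c k) = {x} := by
  have hcard := h.card (Nat.le_succ k)
  have hw : f.vecWinners n (c k).card = {c k} := by rw [hcard]; exact h.2 k (Nat.le_succ k)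
  have hlt : (c k).card < Fintype.card C := by rw [hcard]; exact hk
  obtain ⟨x, hx⟩ := vecExtend_nonempty ha hfg h.1 hlt hw
  have key : ∀ y ∈ f.vecExtend n (c k), insert y (c k) = c (k + 1) := fun y hy => by
    have := (mem_vecExtend.1 hy).2
    rw [hcard, h.2 (k + 1) le_rfl] at this
    exact Finset.mem_singleton.1 this
  refine ⟨x, (key x hx).symm, (mem_vecExtend.1 hx).1,
    Finset.eq_singleton_iff_unique_mem.2 ⟨hx, fun y hy => ?_⟩⟩
  have : y ∈ insert x (c k) := by
    rw [key x hx, ← key y hy]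
    exact Finset.mem_insert_self _ _
  exact (Finset.mem_insert.1 this).resolve_right (mem_vecExtend.1 hy).1

theorem vecWinners_succ_eq_singleton (ha : f.IsAnonymous) (hfg : f.IsGeneratedBy g)
    {n : Ballot C → ℤ} (hn : 0 < n) {W : Finset C} (hW : W.card < Fintype.card C)
    (h : f.vecWinners n W.card = {W}) {x : C} (hx : f.vecExtend n W = {x}) :
    f.vecWinners n (W.card + 1) = {insert x W} := by
  rw [vecWinners_succ ha hfg hn hW h, hx, Finset.image_singleton]

theorem Follows.add (ha : f.IsAnonymous) (hg : g.IsConsistent) (hfg : f.IsGeneratedBy g)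
    {c : ℕ → Finset C} {k : ℕ} (hk : k ≤ Fintype.card C) {n n' : Ballot C → ℤ}
    (h : f.Follows c k n) (h' : f.Follows c k n') : f.Follows c k (n + n') := by
  have hpos := add_pos h.1 h'.1
  refine ⟨hpos, fun i => ?_⟩
  induction i with
  | zero =>
    intro _
    rw [← h.2 0 (Nat.zero_le k), vecWinners_zero hpos, vecWinners_zero h.1]
  | succ i ih =>
    intro hi
    have ih := ih (Nat.le_of_succ_le hi)
    have hcard := h.card (Nat.le_of_succ_le hi)
    obtain ⟨x, hx, -, hxn⟩ := (h.mono hi).exists_vecExtend_eq ha hfg (hi.trans hk)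
    obtain ⟨y, hy, hyc, hyn⟩ := (h'.mono hi).exists_vecExtend_eq ha hfg (hi.trans hk)
    have hxy : y = x := by
      have : y ∈ insert x (c i) := by
        rw [← hx, hy]
        exact Finset.mem_insert_self _ _
      exact (Finset.mem_insert.1 this).resolve_right hyc
    subst hxy
    have hlt : (c i).card < Fintype.card C := by rw [hcard]; exact hi.trans hk
    have hw : f.vecWinners (n + n') (c i).card = {c i} := by rw [hcard]; exact ih
    have hadd := vecExtend_add ha hg hfg h.1 h'.1 hlt
      (by rw [hcard]; exact h.2 i (Nat.le_of_succ_le hi))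
      (by rw [hcard]; exact h'.2 i (Nat.le_of_succ_le hi)) hw (by simp [hxn, hyn])
    rw [hxn, hyn, Finset.inter_self] at hadd
    have := vecWinners_succ_eq_singleton ha hfg hpos hlt hw hadd
    rwa [hcard, ← hx] at this

theorem Follows.nsmul (ha : f.IsAnonymous) (hg : g.IsConsistent) (hfg : f.IsGeneratedBy g)
    {c : ℕ → Finset C} {k : ℕ} (hk : k ≤ Fintype.card C) {n : Ballot C → ℤ}
    (h : f.Follows c k n) {j : ℕ} (hj : 1 ≤ j) : f.Follows c k (j • n) := by
  induction j, hj using Nat.le_induction with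
  | base => rwa [one_nsmul]
  | succ j _ ih => rw [succ_nsmul]; exact ih.add ha hg hfg hk h

theorem Follows.add_nsmul (ha : f.IsAnonymous) (hg : g.IsConsistent) (hfg : f.IsGeneratedBy g)
    {c : ℕ → Finset C} {k : ℕ} (hk : k ≤ Fintype.card C) {n n' : Ballot C → ℤ}
    (h : f.Follows c k n) (h' : f.Follows c k n') (j : ℕ) : f.Follows c k (n + j • n') := by
  rcases Nat.eq_zero_or_pos j with rfl | hj
  · rwa [zero_nsmul, add_zero]
  · exact h.add ha hg hfg hk (h'.nsmul ha hg hfg hk hj)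

/-- Continuity provides one good multiple for one size only. Consistency makes it hold for all
larger multiples, and induction on the size for the whole chain. -/
theorem Follows.eventually (ha : f.IsAnonymous) (hc : f.IsContinuous) (hg : g.IsConsistent)
    (hfg : f.IsGeneratedBy g) {c : ℕ → Finset C} {k : ℕ} (hk : k ≤ Fintype.card C)
    {n n' : Ballot C → ℤ} (h : f.Follows c k n) (hn' : 0 < n') :
    ∃ J : ℕ, ∀ j ≥ J, f.Follows c k (j • n + n') := by
  have hpos : ∀ j : ℕ, 0 < j • n + n' := fun j =>
    add_pos_of_nonneg_of_pos (nsmul_nonneg h.1.le j) hn'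
  suffices H : ∀ i ≤ k, ∃ J : ℕ, ∀ j ≥ J, f.Follows c i (j • n + n') from H k le_rfl
  intro i
  induction i with
  | zero =>
    refine fun _ => ⟨0, fun j _ => ⟨hpos j, fun i hi => ?_⟩⟩
    obtain rfl := Nat.le_zero.1 hi
    rw [← h.2 0 (Nat.zero_le k), vecWinners_zero (hpos j), vecWinners_zero h.1]
  | succ i ih =>
    intro hi
    obtain ⟨J, hJ⟩ := ih (Nat.le_of_succ_le hi)
    have hJn := h.nsmul ha hg hfg hk (Nat.le_add_left 1 J)
    obtain ⟨l, hl, hl'⟩ := exists_vecWinners_add_eq ha hc hJn.1 hn' (hi.trans hk) (hJn.2 _ hi)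
    rw [← mul_nsmul'] at hl'
    -- Continuity is applied to `(J + 1) • n`, so that the multiple obtained is at least `J` and the
    -- smaller sizes stay correct.
    refine ⟨l * (J + 1), fun j hj => ?_⟩
    obtain ⟨r, rfl⟩ := Nat.exists_eq_add_of_le hj
    have hbase : f.Follows c (i + 1) ((l * (J + 1)) • n + n') := by
      refine ⟨hpos _, fun t ht => ?_⟩
      rcases Nat.le_succ_iff.1 ht with ht | rfl
      · exact (hJ _ (by nlinarith)).2 t ht
      · exact hl'
    have := hbase.add_nsmul ha hg hfg (hi.trans hk) (h.mono hi) r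
    rwa [add_right_comm, ← _root_.add_nsmul] at this

end ABCVotingRule

namespace ABCVotingRule

variable {C : Type*} [Fintype C] [DecidableEq C] {f : ABCVotingRule C} {g : GeneratorFunction C}

theorem Follows.vecWinners_card {c : ℕ → Finset C} {k : ℕ} {n : Ballot C → ℤ}
    (h : f.Follows c k n) : f.vecWinners n (c k).card = {c k} := by
  rw [h.card le_rfl]
  exact h.2 k le_rfl

theorem Follows.vecExtend_add (ha : f.IsAnonymous) (hg : g.IsConsistent) (hfg : f.IsGeneratedBy g)
    {c : ℕ → Finset C} {k : ℕ} (hk : k < Fintype.card C) {n n' : Ballot C → ℤ}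
    (h : f.Follows c k n) (h' : f.Follows c k n')
    (hne : (f.vecExtend n (c k) ∩ f.vecExtend n' (c k)).Nonempty) :
    f.vecExtend (n + n') (c k) = f.vecExtend n (c k) ∩ f.vecExtend n' (c k) :=
  ABCVotingRule.vecExtend_add ha hg hfg h.1 h'.1 (by rwa [h.card le_rfl]) h.vecWinners_card
    h'.vecWinners_card (h.add ha hg hfg hk.le h').vecWinners_card hne

theorem Follows.vecExtend_nonempty (ha : f.IsAnonymous) (hfg : f.IsGeneratedBy g)
    {c : ℕ → Finset C} {k : ℕ} (hk : k < Fintype.card C) {n : Ballot C → ℤ}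
    (h : f.Follows c k n) : (f.vecExtend n (c k)).Nonempty :=
  ABCVotingRule.vecExtend_nonempty ha hfg h.1 (by rwa [h.card le_rfl]) h.vecWinners_card

theorem Follows.vecExtend_nsmul (ha : f.IsAnonymous) (hg : g.IsConsistent)
    (hfg : f.IsGeneratedBy g) {c : ℕ → Finset C} {k : ℕ} (hk : k < Fintype.card C)
    {n : Ballot C → ℤ} (h : f.Follows c k n) {j : ℕ} (hj : 1 ≤ j) :
    f.vecExtend (j • n) (c k) = f.vecExtend n (c k) := by
  have hne := h.vecExtend_nonempty ha hfg hk
  induction j, hj using Nat.le_induction with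
  | base => rw [one_nsmul]
  | succ j hj ih =>
    rw [succ_nsmul, (h.nsmul ha hg hfg hk.le hj).vecExtend_add ha hg hfg hk h (by
      rwa [ih, Finset.inter_self]), ih, Finset.inter_self]

/-- A tie among the extensions of `c k` is broken in favour of `y` by one copy of a profile at which
the generator picks `y` alone; enough copies of `n` keep the chain up to `c k`. -/
theorem exists_follows (hP : f.IsProper) (hg : g.IsConsistent) (hfg : f.IsGeneratedBy g) (k : ℕ)
    (hk : k ≤ Fintype.card C) : ∃ c n, f.Follows c k n := by
  obtain ⟨ha, -, hc, hi⟩ := id hP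
  induction k with
  | zero =>
    obtain ⟨A, -⟩ := hi ∅
    refine ⟨fun _ => ∅, A.count, A.count_pos, fun i hi => ?_⟩
    obtain rfl := Nat.le_zero.1 hi
    exact vecWinners_zero A.count_pos
  | succ k ih =>
    obtain ⟨c, n, h⟩ := ih (Nat.le_of_succ_le hk)
    obtain ⟨y, hy⟩ := h.vecExtend_nonempty ha hfg hk
    have hyc := (mem_vecExtend.1 hy).1
    have hcard := h.card (le_refl k)
    have hlt : (c k).card < Fintype.card C := by rw [hcard]; exact hk
    obtain ⟨D, hD, hDA⟩ := exists_extend_eq_singleton hP hfg hyc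
    obtain ⟨J, hJ⟩ := h.eventually ha hc hg hfg (Nat.le_of_succ_le hk) hD
    have hJ' := hJ (J + 1) (Nat.le_succ J)
    have hn := h.nsmul ha hg hfg (Nat.le_of_succ_le hk) (Nat.le_add_left 1 J)
    have hext := h.vecExtend_nsmul ha hg hfg hk (Nat.le_add_left 1 J)
    have hsing : f.vecExtend ((J + 1) • n + D) (c k) = {y} := by
      have h1 := hn.vecWinners_card
      have h2 := hJ'.vecWinners_card
      have h3 := hJ'.vecExtend_nonempty ha hfg hk
      -- The argument returns to profiles because at `D` only the generator is known: `c k` need not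
      -- be the sole winner there.
      obtain ⟨A, hA, -⟩ := ApprovalProfile.exists_count_eq hn.1.le hn.1.ne' ∅
      obtain ⟨A', rfl, hd⟩ := ApprovalProfile.exists_count_eq hD.le hD.ne' A.electorate
      rw [← hA] at h1 h2 h3 hext ⊢
      rw [← ApprovalProfile.count_add hd.symm] at h2 h3 ⊢
      rw [vecWinners_count ha _ hlt.le] at h1 h2
      rw [← extend_eq_vecExtend ha hfg hlt h1] at hext
      rw [← extend_eq_vecExtend ha hfg hlt h2] at h3 ⊢
      have hinter : g.extend A (c k) ∩ g.extend A' (c k) = {y} := by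
        rw [(hDA A' rfl).2, hext]
        exact Finset.inter_singleton_of_mem hy
      rw [hg A A' hd.symm (c k) (fun e => by simp [e] at hlt) (by simp [hinter]) h3, hinter]
    refine ⟨Function.update c (k + 1) (insert y (c k)), (J + 1) • n + D, hJ'.1, fun i hi => ?_⟩
    rcases Nat.le_succ_iff.1 hi with hi | rfl
    · rw [Function.update_of_ne (by omega)]
      exact hJ'.2 i hi
    · rw [Function.update_self]
      have := vecWinners_succ_eq_singleton ha hfg hJ'.1 hlt hJ'.vecWinners_card hsing
      rwa [hcard] at this

theorem Follows.perm (ha : f.IsAnonymous) (hn : f.IsNeutral) {c : ℕ → Finset C} {k : ℕ}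
    (hk : k ≤ Fintype.card C) {n : Ballot C → ℤ} (h : f.Follows c k n) (τ : Equiv.Perm C) :
    f.Follows (fun i => (c i).map τ.toEmbedding) k (permVec τ n) :=
  ⟨permVec_pos τ h.1, fun i hi => by
    rw [vecWinners_perm ha hn h.1 (hi.trans hk), h.2 i hi, Finset.image_singleton]⟩

theorem Follows.subset (ha : f.IsAnonymous) (hfg : f.IsGeneratedBy g) {c : ℕ → Finset C} {k : ℕ}
    (hk : k ≤ Fintype.card C) {n : Ballot C → ℤ} (h : f.Follows c k n) {i : ℕ} (hi : i ≤ k) :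
    c i ⊆ c k := by
  induction k, hi using Nat.le_induction with
  | base => exact subset_rfl
  | succ k hik ih =>
    obtain ⟨x, hx, -, -⟩ := h.exists_vecExtend_eq ha hfg hk
    rw [hx]
    exact (ih (Nat.le_of_succ_le hk) (h.mono (Nat.le_succ k))).trans (Finset.subset_insert _ _)

/-! ### Extending the generator at a fixed committee to all integral vectors. -/

/-- There is a vector with full support that leads to `W` without ties, and then to a tie between
all candidates outside `W`. -/
theorem exists_base (hP : f.IsProper) (hg : g.IsConsistent) (hfg : f.IsGeneratedBy g) {W : Finset C}
    (hW : W.card < Fintype.card C) :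
    ∃ c e, f.Follows c W.card e ∧ c W.card = W ∧ f.vecExtend e W = Wᶜ ∧ 1 ≤ e := by
  classical
  obtain ⟨ha, hn, hc, -⟩ := id hP
  obtain ⟨c, n, h⟩ := exists_follows hP hg hfg W.card hW.le
  obtain ⟨σ, hσ⟩ := Equiv.Perm.exists_map_finset_eq (c W.card) W (h.card le_rfl)
  replace h := h.perm ha hn hW.le σ
  generalize permVec σ n = n at h
  obtain ⟨c, hcW, h⟩ : ∃ c' : ℕ → Finset C, c' W.card = W ∧ f.Follows c' W.card n := ⟨_, hσ, h⟩
  -- Permutations that fix `W` pointwise preserve the whole chain, whose members lie in `W`; summing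
  -- over them gives symmetry outside `W`.
  let H : Finset (Equiv.Perm C) := Finset.univ.filter fun τ => ∀ w ∈ W, τ w = w
  have hH : ∀ τ, τ ∈ H ↔ ∀ w ∈ W, τ w = w := fun τ => by simp [H]
  have hfix : ∀ τ ∈ H, ∀ i ≤ W.card, (c i).map τ.toEmbedding = c i := fun τ hτ i hi => by
    refine Finset.eq_of_subset_of_card_le (fun w hw => ?_) (Finset.card_map _).ge
    obtain ⟨v, hv, rfl⟩ := Finset.mem_map.1 hw
    have hvW : v ∈ W := by
      have := h.subset ha hfg hW.le hi hv
      rwa [hcW] at this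
    rw [Equiv.coe_toEmbedding, (hH τ).1 hτ v hvW]
    exact hv
  have hHn : ∀ τ ∈ H, f.Follows c W.card (permVec τ n) := fun τ hτ => by
    have := h.perm ha hn hW.le τ
    exact ⟨this.1, fun i hi => (this.2 i hi).trans (congrArg _ (hfix τ hτ i hi))⟩
  have hsum : f.Follows c W.card (∑ τ ∈ H, permVec τ n) :=
    Finset.sum_induction_nonempty _ (f.Follows c W.card)
      (fun a b ha' hb' => ha'.add ha hg hfg hW.le hb') ⟨1, (hH 1).2 fun _ _ => rfl⟩ hHn
  have hone : (0 : Ballot C → ℤ) < 1 := by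
    have hex : ∃ x, x ∉ W := by
      by_contra hno
      push Not at hno
      rw [Finset.eq_univ_iff_forall.2 hno, Finset.card_univ] at hW
      exact lt_irrefl _ hW
    obtain ⟨x, -⟩ := hex
    have : Nonempty (Ballot C) := ⟨⟨{x}, Finset.singleton_nonempty x⟩⟩
    exact one_pos
  obtain ⟨J, hJ⟩ := hsum.eventually ha hc hg hfg hW.le hone
  have hE := hJ J le_rfl
  -- The summand 1 casts every ballot once: it gives full support without disturbing the symmetry.
  set E := J • ∑ τ ∈ H, permVec τ n + 1 with hEdef
  have hinv : ∀ τ ∈ H, permVec τ E = E := fun τ hτ => by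
    rw [hEdef, map_add, map_nsmul, map_sum]
    congr 2
    simp only [permVec_permVec]
    refine Finset.sum_nbij' (fun ρ => τ * ρ) (fun ρ => τ⁻¹ * ρ) (fun ρ hρ => ?_) (fun ρ hρ => ?_)
      (fun ρ _ => inv_mul_cancel_left τ ρ) (fun ρ _ => mul_inv_cancel_left τ ρ) fun _ _ => rfl
    · refine (hH _).2 fun w hw => ?_
      rw [Equiv.Perm.mul_apply, (hH ρ).1 hρ w hw, (hH τ).1 hτ w hw]
    · refine (hH _).2 fun w hw => ?_
      rw [Equiv.Perm.mul_apply, (hH ρ).1 hρ w hw]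
      exact Equiv.Perm.inv_eq_iff_eq.2 ((hH τ).1 hτ w hw).symm
  refine ⟨c, E, hE, hcW, ?_, ?_⟩
  · obtain ⟨y, hy⟩ := hE.vecExtend_nonempty ha hfg hW
    rw [hcW] at hy
    have hyW := (mem_vecExtend.1 hy).1
    ext x
    rw [Finset.mem_compl]
    refine ⟨fun hx => (mem_vecExtend.1 hx).1, fun hx => ?_⟩
    have hs : Equiv.swap y x ∈ H := (hH _).2 fun w hw => Equiv.swap_apply_of_ne_of_ne
      (fun e => hyW (e ▸ hw)) (fun e => hx (e ▸ hw))
    have := vecExtend_perm ha hn hE.1 hW (Equiv.swap y x)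
    rw [hinv _ hs, Finset.map_swap_eq_self hyW hx] at this
    rw [this, Finset.mem_map_equiv, Equiv.symm_swap, Equiv.swap_apply_right]
    exact hy
  · rw [hEdef]
    exact le_add_of_nonneg_left (nsmul_nonneg hsum.1.le J)

/-- The extension of the generator function at `W` to all integral vectors. -/
structure IsExtensionAt (f : ABCVotingRule C) (g : GeneratorFunction C) (W : Finset C)
    (G : (Ballot C → ℤ) → Finset C) : Prop where
  nonempty : ∀ n, (G n).Nonempty
  notMem : ∀ n, ∀ x ∈ G n, x ∉ W
  add_eq : ∀ n n', (G n ∩ G n').Nonempty → G (n + n') = G n ∩ G n'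
  zero : ∀ x, x ∉ W → x ∈ G 0
  continuous : ∀ n x, G n = {x} → ∀ n', ∃ j : ℕ, 1 ≤ j ∧ G (j • n + n') = {x}
  extend_eq : ∀ A : ApprovalProfile C, W ∈ f.winners A W.card → g.extend A W = G A.count
  exists_pos : ∀ n, ∃ e, 0 < e ∧ 0 < n + e ∧ G e = Wᶜ ∧ f.vecWinners e W.card = {W} ∧
    f.vecWinners (n + e) W.card = {W}

theorem exists_isExtensionAt (hP : f.IsProper) (hg : g.IsConsistent) (hfg : f.IsGeneratedBy g)
    {W : Finset C} (hW : W.card < Fintype.card C) : ∃ G, IsExtensionAt f g W G := by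
  obtain ⟨ha, hn, hc, -⟩ := id hP
  obtain ⟨c, E, hE, hcW, hext, hE1⟩ := exists_base hP hg hfg hW
  have hballot : Nonempty (Ballot C) := by
    by_contra hno
    rw [not_nonempty_iff] at hno
    exact hE.1.ne (Subsingleton.elim _ _)
  -- Full support first makes `n + J₀ • E` positive; further copies of `E` then force the chain.
  have hev : ∀ n, ∃ J : ℕ, ∀ j ≥ J, f.Follows c W.card (n + j • E) := fun n => by
    obtain ⟨J₀, hJ₀⟩ := Function.exists_nsmul_pos hE1 n
    obtain ⟨J, hJ⟩ := hE.eventually ha hc hg hfg hW.le hJ₀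
    refine ⟨J₀ + J, fun j hj => ?_⟩
    obtain ⟨r, rfl⟩ := Nat.exists_eq_add_of_le hj
    have := hJ (J + r) (Nat.le_add_right _ _)
    rwa [add_comm, add_assoc, ← add_nsmul, ← add_assoc] at this
  have hadd : ∀ n n', f.Follows c W.card n → f.Follows c W.card n' →
      (f.vecExtend n W ∩ f.vecExtend n' W).Nonempty →
      f.vecExtend (n + n') W = f.vecExtend n W ∩ f.vecExtend n' W := fun n n' h h' hne => by
    have := h.vecExtend_add ha hg hfg hW h'
    rw [hcW] at this
    exact this hne
  have hnon : ∀ n, f.Follows c W.card n → (f.vecExtend n W).Nonempty := fun n h => by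
    have := h.vecExtend_nonempty ha hfg hW
    rwa [hcW] at this
  have hwin : ∀ n, f.Follows c W.card n → f.vecWinners n W.card = {W} := fun n h => by
    have := h.vecWinners_card
    rwa [hcW] at this
  have hsub : ∀ n, f.vecExtend n W ⊆ Wᶜ := fun n x hx =>
    Finset.mem_compl.2 (mem_vecExtend.1 hx).1
  -- All candidates outside `W` tie at `E`, so by consistency further copies of `E` do not change
  -- the extensions.
  have hconst : ∀ n, f.Follows c W.card n → ∀ i : ℕ,
      f.vecExtend (n + i • E) W = f.vecExtend n W := fun n h i => by
    induction i with
    | zero => rw [zero_nsmul, add_zero]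
    | succ i ih =>
      have hinter : f.vecExtend (n + i • E) W ∩ f.vecExtend E W = f.vecExtend n W := by
        rw [ih, hext, Finset.inter_eq_left.2 (hsub n)]
      rw [succ_nsmul, ← add_assoc, hadd _ _ (h.add_nsmul ha hg hfg hW.le hE i) hE
        (by rw [hinter]; exact hnon n h), hinter]
  choose J hJ using hev
  let G : (Ballot C → ℤ) → Finset C := fun n => f.vecExtend (n + J n • E) W
  have hG : ∀ n (j : ℕ), f.Follows c W.card (n + j • E) → f.vecExtend (n + j • E) W = G n := by
    intro n j h
    have h1 := hconst _ h (J n)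
    have h2 := hconst _ (hJ n (J n) le_rfl) j
    rw [← h1, add_right_comm, h2]
  have hGE : ∀ j : ℕ, 1 ≤ j → G (j • E) = Wᶜ := fun j hj => by
    have h1 := hG (j • E) 0 (by
      rw [zero_nsmul, add_zero]
      exact hE.nsmul ha hg hfg hW.le hj)
    obtain ⟨i, rfl⟩ := Nat.exists_eq_add_of_le' hj
    rw [← h1, zero_nsmul, add_zero, succ_nsmul', hconst E hE, hext]
  refine ⟨G, fun n => hnon _ (hJ n _ le_rfl), fun n x hx => (mem_vecExtend.1 hx).1,
    fun n n' hne => ?_, fun x hx => ?_, fun n x hx n' => ?_, fun A hA => ?_, fun n => ?_⟩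
  · have h1 := hJ n _ le_rfl
    have h2 := hJ n' _ le_rfl
    have h3 := h1.add ha hg hfg hW.le h2
    have h4 := hadd _ _ h1 h2 hne
    rw [add_add_add_comm, ← add_nsmul] at h3 h4
    rw [← hG _ _ h3, h4]
  · have h1 := hG 0 1 (by rwa [zero_add, one_nsmul])
    rw [← h1, zero_add, one_nsmul, hext]
    exact Finset.mem_compl.2 hx
  · have h1 := hJ n _ le_rfl
    have h2 := hJ n' _ le_rfl
    have hs := vecWinners_succ_eq_singleton ha hfg h1.1 hW (hwin _ h1) hx
    obtain ⟨l, hl, hl'⟩ := exists_vecWinners_add_eq ha hc h1.1 h2.1 hW hs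
    have h3 := (h1.nsmul ha hg hfg hW.le hl).add ha hg hfg hW.le h2
    have h4 : l • (n + J n • E) + (n' + J n' • E) =
        (l • n + n') + (l * J n + J n') • E := by
      rw [smul_add, add_add_add_comm, ← mul_nsmul', ← add_nsmul]
    refine ⟨l, hl, ?_⟩
    have hxW := (mem_vecExtend.1 (show x ∈ f.vecExtend _ W from
      hx ▸ Finset.mem_singleton_self x)).1
    have h5 := hnon _ h3
    have h6 : f.vecExtend (l • (n + J n • E) + (n' + J n' • E)) W = {x} := by
      refine Finset.eq_singleton_iff_nonempty_unique_mem.2 ⟨h5, fun y hy => ?_⟩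
      obtain ⟨hyW, hy⟩ := mem_vecExtend.1 hy
      rw [hl', Finset.mem_singleton] at hy
      have : y ∈ insert x W := hy ▸ Finset.mem_insert_self y W
      exact (Finset.mem_insert.1 this).resolve_right hyW
    rw [h4] at h3 h6
    rw [← hG _ _ h3, h6]
  -- One extra copy ensures that the added multiple of `E` is non-zero, hence comes from a profile.
  · have h1 := hJ A.count (J A.count + 1) (Nat.le_succ _)
    have h2 := hE.nsmul ha hg hfg hW.le (Nat.le_add_left 1 (J A.count))
    have h3 : f.vecExtend ((J A.count + 1) • E) W = Wᶜ := by
      rw [succ_nsmul', hconst E hE, hext]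
    rw [extend_eq_vecExtend_add ha hg hfg h2.1 hW hA (hwin _ h2) (hwin _ h1) h3, hG _ _ h1]
  · have h1 := hJ n (J n + 1) (Nat.le_succ _)
    have h2 := hE.nsmul ha hg hfg hW.le (Nat.le_add_left 1 (J n))
    exact ⟨_, h2.1, h1.1, hGE _ (Nat.le_add_left 1 _), hwin _ h2, hwin _ h1⟩

namespace IsExtensionAt

theorem eq_vecExtend (ha : f.IsAnonymous) (hfg : f.IsGeneratedBy g) {W : Finset C}
    (hW : W.card < Fintype.card C) {G : (Ballot C → ℤ) → Finset C} (h : IsExtensionAt f g W G)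
    {n : Ballot C → ℤ} (hn : 0 < n) (hw : f.vecWinners n W.card = {W}) :
    G n = f.vecExtend n W := by
  obtain ⟨A, rfl, -⟩ := ApprovalProfile.exists_count_eq hn.le hn.ne' ∅
  rw [vecWinners_count ha _ hW.le] at hw
  rw [← h.extend_eq A (by simp [hw]), extend_eq_vecExtend ha hfg hW hw]

/-- The two extensions may come from unrelated base vectors. Where `W` is the sole winner both are
determined by the rule, and neutrality applies; a general `n` is reduced to this case by adding `e`,
which changes neither side. -/
theorem perm (ha : f.IsAnonymous) (hn : f.IsNeutral) (hfg : f.IsGeneratedBy g) {W : Finset C}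
    (hW : W.card < Fintype.card C) (τ : Equiv.Perm C) {G G' : (Ballot C → ℤ) → Finset C}
    (h : IsExtensionAt f g W G) (h' : IsExtensionAt f g (W.map τ.toEmbedding) G')
    (n : Ballot C → ℤ) : G' (permVec τ n) = (G n).map τ.toEmbedding := by
  obtain ⟨e, he, hne, hGe, hw, hw'⟩ := h.exists_pos n
  have hWτ : (W.map τ.toEmbedding).card < Fintype.card C := by rwa [Finset.card_map]
  have key : ∀ n, 0 < n → f.vecWinners n W.card = {W} →
      G' (permVec τ n) = (G n).map τ.toEmbedding := fun n hpos hn' => by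
    rw [h.eq_vecExtend ha hfg hW hpos hn', h'.eq_vecExtend ha hfg hWτ (permVec_pos τ hpos),
      vecExtend_perm ha hn hpos hW]
    rw [Finset.card_map, vecWinners_perm ha hn hpos hW.le, hn', Finset.image_singleton]
  have h1 := key e he hw
  have h2 := key (n + e) hne hw'
  have hsub : G n ⊆ Wᶜ := fun x hx => Finset.mem_compl.2 (h.notMem n x hx)
  have hsub' : G' (permVec τ n) ⊆ (G e).map τ.toEmbedding := fun x hx => by
    have := h'.notMem _ x hx
    rw [Finset.mem_map_equiv] at this ⊢
    rwa [hGe, Finset.mem_compl]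
  have h3 : G (n + e) = G n := by
    have hinter : G n ∩ G e = G n := by rw [hGe, Finset.inter_eq_left.2 hsub]
    rw [h.add_eq n e (by rw [hinter]; exact h.nonempty n), hinter]
  have h4 : G' (permVec τ (n + e)) = G' (permVec τ n) := by
    have hinter : G' (permVec τ n) ∩ G' (permVec τ e) = G' (permVec τ n) := by
      rw [h1, Finset.inter_eq_left.2 hsub']
    rw [map_add, h'.add_eq _ _ (by rw [hinter]; exact h'.nonempty _), hinter]
  rw [← h4, h2, h3]

theorem isConsistentChoice (hP : f.IsProper) (hfg : f.IsGeneratedBy g) {W : Finset C}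
    (hW : W.card < Fintype.card C) {G : (Ballot C → ℤ) → Finset C} (h : IsExtensionAt f g W G) :
    IsConsistentChoice W G where
  nonempty := h.nonempty
  notMem := h.notMem
  add_eq := h.add_eq
  zero := h.zero
  continuous := h.continuous
  perm τ hτ n := h.perm hP.1 hP.2.1 hfg hW τ (by rwa [hτ]) n
  exists_singleton := by
    obtain ⟨y, hy⟩ := h.nonempty 0
    obtain ⟨n, hn, hA⟩ := exists_extend_eq_singleton hP hfg (h.notMem _ y hy)
    obtain ⟨A, rfl, -⟩ := ApprovalProfile.exists_count_eq hn.le hn.ne' ∅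
    exact ⟨A.count, y, by rw [← h.extend_eq A (hA A rfl).1, (hA A rfl).2]⟩

end IsExtensionAt

/-- A generator function of a proper rule maximizes weighted numbers of approvals, where the weights
depend only on the size of the current committee. -/
theorem exists_weight_mem_extend_iff (hP : f.IsProper) (hg : g.IsConsistent)
    (hfg : f.IsGeneratedBy g) :
    ∃ d : ℕ → ℕ → ℕ → ℝ,
      (∀ k, k + 2 ≤ Fintype.card C →
        ∃ a b, a ≤ k ∧ 1 ≤ b ∧ b + k < Fintype.card C ∧ d k a b ≠ 0) ∧
      ∀ A W, W.card < Fintype.card C → W ∈ f.winners A W.card → ∀ z, z ∈ g.extend A W ↔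
        z ∉ W ∧ ∀ w, w ∉ W →
          weightedApproval (d W.card) W w A.count ≤ weightedApproval (d W.card) W z A.count := by
  have hG : ∀ W : Finset C, ∃ G, W.card < Fintype.card C → IsExtensionAt f g W G := fun W => by
    by_cases hW : W.card < Fintype.card C
    · obtain ⟨G, hG⟩ := exists_isExtensionAt hP hg hfg hW
      exact ⟨G, fun _ => hG⟩
    · exact ⟨fun _ => ∅, fun h => absurd h hW⟩
  choose G hG using hG
  have hd : ∀ k, ∃ d : ℕ → ℕ → ℝ, k + 2 ≤ Fintype.card C →
      (∃ a b, a ≤ k ∧ 1 ≤ b ∧ b + k < Fintype.card C ∧ d a b ≠ 0) ∧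
      ∀ W : Finset C, W.card = k → ∀ n z, z ∈ G W n ↔
        z ∉ W ∧ ∀ w, w ∉ W → weightedApproval d W w n ≤ weightedApproval d W z n := fun k => by
    by_cases hk : k + 2 ≤ Fintype.card C
    -- Weights are found for one committee of each size and transported to the others by neutrality.
    · obtain ⟨V, -, hV⟩ := Finset.exists_subset_card_eq (s := (Finset.univ : Finset C)) (n := k)
        (by rw [Finset.card_univ]; omega)
      have hVlt : V.card < Fintype.card C := by omega
      have hVc : Vᶜ.card = Fintype.card C - k := by rw [Finset.card_compl, hV]
      obtain ⟨d, ⟨a, b, h1, h2, h3, h4⟩, h⟩ :=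
        ((hG V hVlt).isConsistentChoice hP hfg hVlt).exists_weight_mem_iff (by omega)
      refine ⟨d, fun _ => ⟨⟨a, b, hV ▸ h1, h2, by omega, h4⟩, fun W hWk n z => ?_⟩⟩
      obtain ⟨τ, rfl⟩ := Equiv.Perm.exists_map_finset_eq V W (by rw [hV, hWk])
      have hperm := (hG V hVlt).perm hP.1 hP.2.1 hfg hVlt τ
        (hG _ (by rwa [Finset.card_map])) (permVec τ⁻¹ n)
      have hn : permVec τ (permVec τ⁻¹ n) = n := by
        rw [permVec_permVec, mul_inv_cancel]
        funext B
        rw [permVec_apply]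
        congr 1
        ext1
        exact Finset.map_refl
      have hwa : ∀ w, weightedApproval d (V.map τ.toEmbedding) (τ w) n =
          weightedApproval d V w (permVec τ⁻¹ n) := fun w => by
        rw [← weightedApproval_permVec d V w _ τ, hn]
      have hmem : ∀ w (s : Finset C), τ w ∈ s.map τ.toEmbedding ↔ w ∈ s := fun w s =>
        Finset.mem_map' _
      rw [hn] at hperm
      obtain ⟨z, rfl⟩ := τ.surjective z
      rw [hperm, hmem, hmem, h]
      refine and_congr_right fun _ => ⟨fun H w hw => ?_, fun H w hw => ?_⟩
      · obtain ⟨w, rfl⟩ := τ.surjective w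
        rw [hwa, hwa]
        exact H w fun hc => hw ((hmem w V).2 hc)
      · have := H (τ w) (mt (hmem w V).1 hw)
        rwa [hwa, hwa] at this
    · exact ⟨fun _ _ => 0, fun h => absurd h hk⟩
  choose d hd using hd
  refine ⟨d, fun k hk => (hd k hk).1, fun A W hW hWA z => ?_⟩
  rw [(hG W hW).extend_eq A hWA]
  by_cases hk : W.card + 2 ≤ Fintype.card C
  · exact (hd W.card hk).2 W rfl A.count z
  -- With a single candidate left the comparison is void, so any weights do.
  · have hone : ∀ w z, w ∉ W → z ∉ W → w = z := fun w z hw hz => by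
      have : Wᶜ.card ≤ 1 := by rw [Finset.card_compl]; omega
      exact Finset.card_le_one.1 this w (Finset.mem_compl.2 hw) z (Finset.mem_compl.2 hz)
    obtain ⟨y, hy⟩ := (hG W hW).nonempty A.count
    have hyW := (hG W hW).notMem _ y hy
    refine ⟨fun hz => ⟨(hG W hW).notMem _ z hz, fun w hw => ?_⟩, fun ⟨hz, _⟩ => ?_⟩
    · rw [hone w z hw ((hG W hW).notMem _ z hz)]
    · rwa [hone z y hz hyW]

end ABCVotingRule

/-! ### Additivity of scores and the counting function built from the weights. -/

namespace ApprovalProfile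

variable {C : Type*} [Fintype C] [DecidableEq C]

theorem score_add (v : Finset C → Finset C → ℝ) {A A' : ApprovalProfile C} (h : A.IsDisjoint A')
    (W : Finset C) : (A.add A').score v W = A.score v W + A'.score v W := by
  rw [score_eq_sum, score_eq_sum, score_eq_sum, count_add h, ← Finset.sum_add_distrib]
  refine Finset.sum_congr rfl fun B _ => ?_
  rw [Pi.add_apply, Int.cast_add, add_mul]

theorem score_of_isCopies (v : Finset C → Finset C → ℝ) {A B : ApprovalProfile C} {j : ℕ}
    (h : A.IsCopies j B) (W : Finset C) : B.score v W = j * A.score v W := by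
  rw [score_eq_sum, score_eq_sum, count_of_isCopies h, Finset.mul_sum]
  refine Finset.sum_congr rfl fun B _ => ?_
  rw [Pi.smul_apply, nsmul_eq_mul, Int.cast_mul, Int.cast_natCast, mul_assoc]

theorem score_permuteVoters {C : Type*} (v : Finset C → Finset C → ℝ) (A : ApprovalProfile C)
    (π : Equiv.Perm ℕ+) (W : Finset C) : (A.permuteVoters π).score v W = A.score v W := by
  simp [score, permuteVoters]

end ApprovalProfile

namespace ABCVotingRule

variable {C : Type*} [Fintype C] [DecidableEq C] {f : ABCVotingRule C}

/-- The score of a counting function with increments `d` is a weighted number of approvals, up to a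
term that does not depend on the added candidate. -/
theorem score_insert_eq (d : ℕ → ℕ → ℕ → ℝ) (A : ApprovalProfile C) {W : Finset C} {x : C}
    (hx : x ∉ W) :
    A.score (fun B W => ∑ a ∈ Finset.range (B ∩ W).card, d (W.card - 1) a (B.card - a))
        (insert x W) =
      ∑ B : Ballot C, A.count B *
          ∑ a ∈ Finset.range (B.1 ∩ W).card, d W.card a (B.1.card - a) +
        weightedApproval (d W.card) W x A.count := by
  rw [ApprovalProfile.score_eq_sum, weightedApproval, ← Finset.sum_add_distrib]
  refine Finset.sum_congr rfl fun B _ => ?_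
  rw [← mul_add, Finset.card_insert_of_notMem hx, Nat.add_sub_cancel]
  congr 1
  split_ifs with hxB
  · rw [Finset.inter_insert_of_mem hxB,
      Finset.card_insert_of_notMem fun hc => hx (Finset.mem_inter.1 hc).2, Finset.sum_range_succ,
      Finset.card_sdiff, Finset.inter_comm W]
  · rw [Finset.inter_insert_of_notMem hxB, add_zero]

theorem isStepDependentSequentialScoringRule_of_isProper (hP : f.IsProper)
    (hcm : f.IsConsistentlyCommitteeMonotone) : f.IsStepDependentSequentialScoringRule := by
  obtain ⟨g, hg, hfg⟩ := hcm
  obtain ⟨d, hd0, hd⟩ := exists_weight_mem_extend_iff hP hg hfg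
  refine ⟨fun t y z => ∑ a ∈ Finset.range t, d (y - 1) a (z - a), ?_, fun A =>
    ⟨f.winners_zero A, fun k hk => ?_⟩⟩
  · intro y hy
    rw [Finset.mem_Icc] at hy
    obtain ⟨a, b, ha, hb, hab, hne⟩ := hd0 (y - 1) (by omega)
    -- The increment of `h` from `a` to `a + 1` at ballot size `a + b` is the non-zero weight; the
    -- index `y - 1` is the size before the step.
    refine ⟨a + 1, Finset.mem_Icc.2 ⟨by omega, by omega⟩, a + b,
      Finset.mem_Icc.2 ⟨by omega, by omega⟩, ?_⟩
    simpa [Finset.sum_range_succ] using hne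
  · rw [(hfg A k hk).2]
    ext V
    simp only [Set.mem_ofPred_eq]
    refine exists_congr fun W => and_congr_right fun hW => exists_congr fun x => ?_
    obtain rfl := f.card_eq _ _ _ hW
    rw [hd A W hk hW, and_assoc]
    refine and_congr_right fun hx => and_congr_left fun _ => ?_
    refine forall_congr' fun y => forall_congr' fun hy => ?_
    rw [score_insert_eq d A hx, score_insert_eq d A hy, ge_iff_le, add_le_add_iff_left]

/-! ### Axioms satisfied by sequential valuation rules. -/

open Classical in
/-- The generator function of a sequential valuation rule. -/
noncomputable def argmaxGenerator (v : Finset C → Finset C → ℝ) : GeneratorFunction C where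
  extend A W := Finset.univ.filter fun x =>
    x ∉ W ∧ ∀ y, y ∉ W → A.score v (insert x W) ≥ A.score v (insert y W)
  notMem _ _ _ hx := (Finset.mem_filter.1 hx).2.1

theorem mem_argmaxGenerator (v : Finset C → Finset C → ℝ) (A : ApprovalProfile C) (W : Finset C)
    (x : C) : x ∈ (argmaxGenerator v).extend A W ↔
      x ∉ W ∧ ∀ y, y ∉ W → A.score v (insert x W) ≥ A.score v (insert y W) := by
  simp [argmaxGenerator]

/-- Once two functions share a maximizer, the maximizers of their sum are exactly the common ones.
-/
theorem argmaxGenerator_isConsistent (v : Finset C → Finset C → ℝ) :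
    (argmaxGenerator v).IsConsistent := by
  rintro A A' hd W - ⟨z, hz⟩ -
  rw [Finset.mem_inter, mem_argmaxGenerator, mem_argmaxGenerator] at hz
  obtain ⟨⟨hzW, hz⟩, -, hz'⟩ := hz
  ext x
  rw [Finset.mem_inter, mem_argmaxGenerator, mem_argmaxGenerator, mem_argmaxGenerator]
  simp only [ApprovalProfile.score_add v hd]
  constructor
  · rintro ⟨hx, h⟩
    have h1 := h z hzW
    have h2 := hz x hx
    have h3 := hz' x hx
    exact ⟨⟨hx, fun y hy => by linarith [hz y hy]⟩, hx, fun y hy => by linarith [hz' y hy]⟩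
  · rintro ⟨⟨hx, h⟩, -, h'⟩
    exact ⟨hx, fun y hy => add_le_add (h y hy) (h' y hy)⟩

namespace IsSequentialValuationRuleOf

variable {v : Finset C → Finset C → ℝ}

theorem mem_winners_succ (h : f.IsSequentialValuationRuleOf v) (A : ApprovalProfile C) {k : ℕ}
    (hk : k + 1 ≤ Fintype.card C) (V : Finset C) :
    V ∈ f.winners A (k + 1) ↔ ∃ W ∈ f.winners A k, ∃ x, x ∉ W ∧
      (∀ y, y ∉ W → A.score v (insert x W) ≥ A.score v (insert y W)) ∧ V = insert x W := by
  rw [← Finset.mem_coe, (h A).2 k hk, Set.mem_ofPred_eq]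

theorem isGeneratedBy (h : f.IsSequentialValuationRuleOf v) :
    f.IsGeneratedBy (argmaxGenerator v) := by
  intro A k hk
  refine ⟨fun W hW => ?_, ?_⟩
  · have hWk := f.card_eq _ _ _ hW
    have hne : (Wᶜ).Nonempty := by
      rw [← Finset.card_pos, Finset.card_compl]
      omega
    obtain ⟨x, hx, hmax⟩ := Finset.exists_max_image Wᶜ (fun x => A.score v (insert x W)) hne
    exact ⟨x, (mem_argmaxGenerator v A W x).2
      ⟨Finset.mem_compl.1 hx, fun y hy => hmax y (Finset.mem_compl.2 hy)⟩⟩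
  · ext V
    simp only [Finset.mem_coe, h.mem_winners_succ A hk, mem_argmaxGenerator, Set.mem_ofPred_eq,
      and_assoc]

theorem isAnonymous (h : f.IsSequentialValuationRuleOf v) : f.IsAnonymous := by
  intro A k hk π
  induction k with
  | zero => rw [(h A).1, (h _).1]
  | succ k ih =>
    ext V
    rw [h.mem_winners_succ A hk, h.mem_winners_succ _ hk, ih (Nat.le_of_succ_le hk)]
    simp only [ApprovalProfile.score_permuteVoters]

theorem isNeutral (h : f.IsSequentialValuationRuleOf v)
    (hv : ∀ (τ : Equiv.Perm C) B W, v (B.map τ.toEmbedding) (W.map τ.toEmbedding) = v B W) :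
    f.IsNeutral := by
  intro A k hk τ
  have hscore : ∀ W, (A.permuteCandidates τ).score v (W.map τ.toEmbedding) = A.score v W :=
    fun W => Finset.sum_congr rfl fun i _ => hv τ _ _
  have hins : ∀ W x, insert (τ x) (Finset.map τ.toEmbedding W) =
      (insert x W).map τ.toEmbedding := fun W x => (Finset.map_insert _ _ _).symm
  have hmem : ∀ x W, τ x ∈ Finset.map τ.toEmbedding W ↔ x ∈ W := fun x W => Finset.mem_map' _
  suffices H : f.winners (A.permuteCandidates τ) k =
      (f.winners A k).image fun W => W.map τ.toEmbedding by
    ext V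
    rw [H]
    simp [eq_comm]
  induction k with
  | zero => rw [(h A).1, (h _).1, Finset.image_singleton, Finset.map_empty]
  | succ k ih =>
    ext V
    rw [h.mem_winners_succ _ hk, ih (Nat.le_of_succ_le hk), Finset.mem_image]
    simp only [h.mem_winners_succ A hk, Finset.mem_image]
    constructor
    · rintro ⟨_, ⟨W, hW, rfl⟩, x, hx, hmax, rfl⟩
      obtain ⟨x, rfl⟩ := τ.surjective x
      rw [hmem] at hx
      refine ⟨insert x W, ⟨W, hW, x, hx, fun y hy => ?_, rfl⟩, (hins W x).symm⟩
      have := hmax (τ y) (by rwa [hmem])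
      rwa [hins, hins, hscore, hscore] at this
    · rintro ⟨_, ⟨W, hW, x, hx, hmax, rfl⟩, rfl⟩
      refine ⟨_, ⟨W, hW, rfl⟩, τ x, by rwa [hmem], fun y hy => ?_, (hins W x).symm⟩
      obtain ⟨y, rfl⟩ := τ.surjective y
      rw [hmem] at hy
      rw [hins, hins, hscore, hscore]
      exact hmax y hy

/-- With enough copies every strict comparison made by `A` outweighs `A'`. So at each size the new
winners are among the old ones, even where `A` has ties, and a unique old winner must remain. -/
theorem isContinuous (h : f.IsSequentialValuationRuleOf v) : f.IsContinuous := by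
  intro A A' _ k hk hone
  have hex : ∀ t : Finset C × C × C, ∃ j : ℕ,
      A.score v (insert t.2.1 t.1) < A.score v (insert t.2.2 t.1) →
        A'.score v (insert t.2.1 t.1) - A'.score v (insert t.2.2 t.1) <
          j * (A.score v (insert t.2.2 t.1) - A.score v (insert t.2.1 t.1)) := fun t => by
    by_cases ht : A.score v (insert t.2.1 t.1) < A.score v (insert t.2.2 t.1)
    · obtain ⟨j, hj⟩ := exists_nat_gt ((A'.score v (insert t.2.1 t.1) -
        A'.score v (insert t.2.2 t.1)) /
          (A.score v (insert t.2.2 t.1) - A.score v (insert t.2.1 t.1)))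
      exact ⟨j, fun _ => (div_lt_iff₀ (sub_pos.2 ht)).1 hj⟩
    · exact ⟨0, fun h => absurd h ht⟩
  choose J hJ using hex
  refine ⟨Finset.univ.sup J + 1, Nat.le_add_left _ _, fun B hB hd => ?_⟩
  have hsub : ∀ i ≤ k, f.winners (B.add A') i ⊆ f.winners A i := fun i => by
    induction i with
    | zero => intro _; rw [(h A).1, (h _).1]
    | succ i ih =>
      intro hi V hV
      obtain ⟨W, hW, x, hx, hmax, rfl⟩ := (h.mem_winners_succ _ (hi.trans hk) V).1 hV
      refine (h.mem_winners_succ _ (hi.trans hk) _).2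
        ⟨W, ih (Nat.le_of_succ_le hi) hW, x, hx, fun y hy => ?_, rfl⟩
      by_contra hlt
      rw [ge_iff_le, not_le] at hlt
      have h1 := hJ (W, x, y) hlt
      have h2 := hmax y hy
      rw [ApprovalProfile.score_add v hd, ApprovalProfile.score_add v hd,
        ApprovalProfile.score_of_isCopies v hB, ApprovalProfile.score_of_isCopies v hB] at h2
      have h3 : (J (W, x, y) : ℝ) ≤ (Finset.univ.sup J + 1 : ℕ) := by
        exact_mod_cast (Finset.le_sup (f := J) (Finset.mem_univ (W, x, y))).trans (Nat.le_succ _)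
      have h4 := mul_le_mul_of_nonneg_right h3 (sub_pos.2 hlt).le
      simp only at h1
      linarith
  obtain ⟨W, hW⟩ := Finset.card_eq_one.1 hone
  have := hsub k le_rfl
  rw [hW] at this ⊢
  exact (Finset.subset_singleton_iff.1 this).resolve_left (f.nonempty _ k hk).ne_empty

end IsSequentialValuationRuleOf

end ABCVotingRule

/-! ### Non-imposition by means of a profile without ties. -/

/-- Finitely many non-zero vectors are simultaneously non-orthogonal to some vector of positive
natural numbers. -/
theorem exists_nat_forall_sum_mul_ne_zero {ι β : Type*} [Fintype ι] [Fintype β] (a : ι → β → ℝ)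
    (ha : ∀ i, a i ≠ 0) : ∃ n : β → ℕ, (∀ b, 0 < n b) ∧ ∀ i, ∑ b, n b * a i b ≠ 0 := by
  classical
  let e := Fintype.equivFin β
  -- With powers of one number as coordinates, each sum is a value of a non-zero polynomial, and
  -- only finitely many numbers are roots of their product.
  let p : ι → Polynomial ℝ := fun i => ∑ b, Polynomial.monomial (e b) (a i b)
  have hp : ∀ i, p i ≠ 0 := fun i hi => ha i <| funext fun b => by
    have := congrArg (fun q => Polynomial.coeff q (e b)) hi
    simpa [p, Polynomial.finsetSum_coeff, Polynomial.coeff_monomial, Fin.val_inj] using this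
  have hprod : ∏ i, p i ≠ 0 := Finset.prod_ne_zero_iff.2 fun i _ => hp i
  obtain ⟨t, ht, htr⟩ := ((Set.infinite_range_of_injective (f := fun t : ℕ => ((t + 1 : ℕ) : ℝ))
    (fun s t h => by simpa using h)).sdiff (∏ i, p i).roots.toFinset.finite_toSet).nonempty
  obtain ⟨t, rfl⟩ := ht
  refine ⟨fun b => (t + 1) ^ (e b : ℕ), fun b => by positivity, fun i hi => htr ?_⟩
  rw [Finset.mem_coe, Multiset.mem_toFinset, Polynomial.mem_roots hprod, Polynomial.IsRoot,
    Polynomial.eval_prod]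
  refine Finset.prod_eq_zero (Finset.mem_univ i) ?_
  simp only [p, Polynomial.eval_finsetSum, Polynomial.eval_monomial]
  rw [← hi]
  refine Finset.sum_congr rfl fun b _ => ?_
  push_cast
  ring

namespace ABCVotingRule

variable {C : Type*} [Fintype C] [DecidableEq C] {f : ABCVotingRule C}

/-- For a step-dependent counting function, any two ways to extend a committee are distinguished by
some ballot. -/
theorem exists_ballot_ne {h : ℕ → ℕ → ℕ → ℝ}
    (hh : IsStepDependentCountingFunction (Fintype.card C) h) {W : Finset C} {x y : C}
    (hx : x ∉ W) (hy : y ∉ W) (hxy : x ≠ y) :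
    ∃ B : Ballot C, h (B.1 ∩ insert x W).card (insert x W).card B.1.card ≠
      h (B.1 ∩ insert y W).card (insert y W).card B.1.card := by
  have hcard : (insert y (insert x W)).card = W.card + 2 := by
    rw [Finset.card_insert_of_notMem (by simp [hy, hxy.symm]), Finset.card_insert_of_notMem hx]
  have hle := Finset.card_le_univ (insert y (insert x W))
  rw [hcard] at hle
  obtain ⟨s, hs, z, hz, hne⟩ := hh (W.card + 1) (Finset.mem_Icc.2 ⟨by omega, by omega⟩)
  rw [Finset.mem_Icc] at hs hz
  -- The ballot consists of `x`, `s - 1` members of `W` and `z - s` candidates outside `W` other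
  -- than `x`, `y`. The upper bound on `z` in the counting condition says exactly that enough of the
  -- latter exist.
  obtain ⟨P, hPW, hP⟩ := Finset.exists_subset_card_eq (s := W) (n := s - 1) (by omega)
  obtain ⟨Q, hQW, hQ⟩ := Finset.exists_subset_card_eq (s := (insert y (insert x W))ᶜ) (n := z - s)
    (by rw [Finset.card_compl, hcard]; omega)
  have hQ' : ∀ c ∈ Q, c ≠ y ∧ c ≠ x ∧ c ∉ W := fun c hc => by
    simpa [not_or] using hQW hc
  have hxP : x ∉ P := fun hc => hx (hPW hc)
  have hyP : y ∉ P := fun hc => hy (hPW hc)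
  have hxQ : x ∉ Q := fun hc => (hQ' x hc).2.1 rfl
  have hyQ : y ∉ Q := fun hc => (hQ' y hc).1 rfl
  have hdis : Disjoint P Q := Finset.disjoint_left.2 fun c hP hQ => (hQ' c hQ).2.2 (hPW hP)
  refine ⟨⟨insert x (P ∪ Q), Finset.insert_nonempty _ _⟩, ?_⟩
  have hB : (insert x (P ∪ Q)).card = z := by
    rw [Finset.card_insert_of_notMem (by simp [hxP, hxQ]), Finset.card_union_of_disjoint hdis]
    omega
  have h1 : insert x (P ∪ Q) ∩ insert x W = insert x P := by
    ext c
    simp only [Finset.mem_inter, Finset.mem_insert, Finset.mem_union]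
    have e1 := hQ' c
    have e2 := @hPW c
    tauto
  have h2 : insert x (P ∪ Q) ∩ insert y W = P := by
    ext c
    simp only [Finset.mem_inter, Finset.mem_insert, Finset.mem_union]
    have e1 := hQ' c
    have e2 := @hPW c
    by_cases hcx : c = x
    · subst hcx
      simp [hxy, hx, hxP]
    · tauto
  rw [h1, h2, hB, Finset.card_insert_of_notMem hxP, Finset.card_insert_of_notMem hx,
    Finset.card_insert_of_notMem hy, hP, Nat.sub_add_cancel hs.1]
  exact hne

/-- There is a profile without any ties. -/
theorem exists_forall_winners_eq_singleton [Nonempty C] {h : ℕ → ℕ → ℕ → ℝ}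
    (hh : IsStepDependentCountingFunction (Fintype.card C) h)
    (hf : f.IsSequentialValuationRuleOf fun B W => h (B ∩ W).card W.card B.card) :
    ∃ A : ApprovalProfile C, ∀ k ≤ Fintype.card C, ∃ V, f.winners A k = {V} := by
  classical
  let v : Finset C → Finset C → ℝ := fun B W => h (B ∩ W).card W.card B.card
  obtain ⟨n, hn, hne⟩ := exists_nat_forall_sum_mul_ne_zero
    (fun (t : {t : Finset C × C × C // t.2.1 ∉ t.1 ∧ t.2.2 ∉ t.1 ∧ t.2.1 ≠ t.2.2})
      (B : Ballot C) => v B.1 (insert t.1.2.1 t.1.1) - v B.1 (insert t.1.2.2 t.1.1))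
    (fun t ht => by
      obtain ⟨B, hB⟩ := exists_ballot_ne hh t.2.1 t.2.2.1 t.2.2.2
      exact hB (sub_eq_zero.1 (congrFun ht B)))
  obtain ⟨A, hA, -⟩ := ApprovalProfile.exists_count_eq (n := fun B => (n B : ℤ))
    (fun B => Int.natCast_nonneg _) (fun h0 => by
      exact (hn _).ne' (Int.natCast_eq_zero.1
        (congrFun h0 ⟨Finset.univ, Finset.univ_nonempty⟩))) ∅
  have hscore : ∀ (W : Finset C) (x y : C), x ∉ W → y ∉ W → x ≠ y →
      A.score v (insert x W) ≠ A.score v (insert y W) := fun W x y hx hy hxy he => by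
    refine hne ⟨(W, x, y), hx, hy, hxy⟩ ?_
    rw [ApprovalProfile.score_eq_sum, ApprovalProfile.score_eq_sum, ← sub_eq_zero,
      ← Finset.sum_sub_distrib] at he
    rw [← he]
    refine Finset.sum_congr rfl fun B _ => ?_
    rw [hA, Int.cast_natCast, mul_sub]
  refine ⟨A, fun k => ?_⟩
  induction k with
  | zero => exact fun _ => ⟨∅, (hf A).1⟩
  | succ k ih =>
    intro hk
    obtain ⟨W, hW⟩ := ih (Nat.le_of_succ_le hk)
    obtain ⟨V, hV⟩ := f.nonempty A (k + 1) hk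
    refine ⟨V, Finset.eq_singleton_iff_unique_mem.2 ⟨hV, fun V' hV' => ?_⟩⟩
    rw [hf.mem_winners_succ A hk, hW] at hV hV'
    obtain ⟨_, hW1, x, hx, hmax, rfl⟩ := hV
    obtain rfl := Finset.mem_singleton.1 hW1
    obtain ⟨_, hW2, y, hy, hmax', rfl⟩ := hV'
    obtain rfl := Finset.mem_singleton.1 hW2
    by_contra hne'
    have hxy : x ≠ y := fun e => hne' (by rw [e])
    exact hscore _ x y hx hy hxy (le_antisymm (hmax' x hx) (hmax y hy))

theorem isProper_of_isStepDependentCountingFunction [Nonempty C] {h : ℕ → ℕ → ℕ → ℝ}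
    (hh : IsStepDependentCountingFunction (Fintype.card C) h)
    (hf : f.IsSequentialValuationRuleOf fun B W => h (B ∩ W).card W.card B.card) :
    f.IsProper := by
  have hneut : f.IsNeutral := hf.isNeutral fun τ B W => by
    simp only [← Finset.map_inter, Finset.card_map]
  refine ⟨hf.isAnonymous, hneut, hf.isContinuous, fun W => ?_⟩
  obtain ⟨A, hA⟩ := exists_forall_winners_eq_singleton hh hf
  obtain ⟨V, hV⟩ := hA W.card (Finset.card_le_univ W)
  have hVW : V.card = W.card := f.card_eq A _ V (by simp [hV])
  -- Neutrality moves the unique winner of the right size to `W`.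
  obtain ⟨τ, hτ⟩ := Equiv.Perm.exists_map_finset_eq V W hVW
  refine ⟨A.permuteCandidates τ, ?_⟩
  rw [← Finset.coe_inj, hneut A W.card (Finset.card_le_univ W) τ, hV]
  ext U
  simp [hτ]

end ABCVotingRule

theorem mainTheorem1 {C : Type*} [Fintype C] [DecidableEq C] [Nonempty C] (f : ABCVotingRule C) :
    f.IsStepDependentSequentialScoringRule ↔
      f.IsProper ∧ f.IsConsistentlyCommitteeMonotone := by
  constructor
  · rintro ⟨h, hh, hf⟩
    exact ⟨ABCVotingRule.isProper_of_isStepDependentCountingFunction hh hf,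
      _, ABCVotingRule.argmaxGenerator_isConsistent _, hf.isGeneratedBy⟩
  · rintro ⟨hP, hcm⟩
    exact ABCVotingRule.isStepDependentSequentialScoringRule_of_isProper hP hcm
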